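/- **Setting.** Let $g_1,\dots,g_{m_1}:\mathbb R^{d}\to\mathbb R$ be convex and $C^2$, let $h_1,\dots,h_{m_2}:\mathbb R^{d}\to\mathbb R$ be affine, and suppose $Y=\{y: g_i(y)\le 0\ \forall i,\ h_j(y)=0\ \forall j\}$ is bounded. For $y\in Y$ let $I(y)=\{i: g_i(y)=0\}$. Let $W\subseteq\mathbb R^p$ be closed and convex with non-empty interior, and let $F(w,y)$ be $C^1$ on an open neighbourhood of $W\times Y$. Put $l_F(w)=\min_{y\in Y}F(w,y)$, $S(w)=\arg\min_{y\in Y}F(w,y)$ and, for $I\subseteq\{1,\dots,m_1\}$, $$\mathcal L_I(\lambda,\nu,y\mid w)=F(w,y)+\sum_{i\in I}\lambda_i g_i(y)+\sum_{j}\nu_j h_j(y).$$ The set-valued map $S$ is *locally Lipschitz at* $w\in W$ if there are $\delta>0$ and $L<\infty$ such that the Hausdorff distance satisfies $\mathrm{dist}(S(w),S(w'))\le L\|w-w'\|$ for all $w'\in W$ with $\|w'-w\|<\delta$. A point $y^*\in S(w)$ is *regular* with multipliers $(\lambda^*,\nu^*)$, where $I=I(y^*)$, if: (LICQ) the family $\nabla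 g_i(y^*)$, $i\in I$, $\nabla h_j(y^*)$, $j\le m_2$, is linearly independent; (strict complementarity) $\nabla_yF(w,y^*)+\sum_{i\in I}\lambda_i^*\nabla g_i(y^*)+\sum_j\nu_j^*\nabla h_j(y^*)=0$ with $\lambda_i^*>0$ for all $i\in I$; and $\mathcal L_I$, as a function of $(w,\lambda_I,\nu,y)$, is twice differentiable near $(w,\lambda^*,\nu^*,y^*)$ with second derivative continuous at that point (automatic if $F$ is $C^2$). Here $\nabla^2\mathcal L_I$ is the matrix of second derivatives in $(\lambda_I,\nu,y)$, and for a symmetric matrix $M$, $M^\dagger=U(U^\top MU)^{-1}U^\top$, where the columns of $U$ are an orthonormal system of eigenvectors for all non-zero eigenvalues of $M$. All derivatives of value functions in $w$ (or in $x,\sigma$ below) are taken relative to the domain, so they are ordinary derivatives at interior points and one-sided at the boundary. **Theorem (general form).** Let $w\in W$, suppose $S$ is locally Lipschitz at every point of some neighbourhood of $w$ in $W$, and let $y^*\in S(w)$ be regular with multipliers $(\lambda^*,\nu^*)$. Then $l_F$ is differentiable near $w$, its gradient is differentiable at $w$, and $$\nabla^2 l_F(w)=\nabla^2_{ww}F(w,y^*)-\begin{bmatrix}0&\nabla^2_{wy}F(w,y^*)\end{bmatrix}\big(\nabla^2\mathcal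 L_I(\lambda^*,\nu^*,y^*\mid w)\big)^\dagger\begin{bmatrix}0\\ \nabla^2_{yw}F(w,y^*)\end{bmatrix}.$$ **Theorem (bilevel form).** Let $X\subseteq\mathbb R^n$ be closed and convex with non-empty interior, let $f,g$ be $C^1$ on an open neighbourhood of $X\times Y$, let $\sigma_0>0$, and put $h_\sigma=\sigma f+g$, $l(x,\sigma)=\min_{y\in Y}h_\sigma(x,y)$, $T(x,\sigma)=\arg\min_{y\in Y}h_\sigma(x,y)$ on $X\times[0,\sigma_0]$. Let $(x,\sigma)\in X\times[0,\sigma_0]$, suppose $T$ is locally Lipschitz at every point of some neighbourhood of $(x,\sigma)$ in $X\times[0,\sigma_0]$, and let $y^*\in T(x,\sigma)$ be regular with multipliers $(\lambda^*,\nu^*)$ (with $w=(x,\sigma)$, $F=h_\sigma$). Then the first partial derivatives of $l$ exist near $(x,\sigma)$, both mixed second derivatives of $l$ exist at $(x,\sigma)$, and $$\frac{\partial^2 l}{\partial\sigma\,\partial x}(x,\sigma)=\frac{\partial^2 l}{\partial x\,\partial\sigma}(x,\sigma)=\nabla_xf(x,y^*)-\begin{bmatrix}0&\nabla^2_{xy}h_\sigma(x,y^*)\end{bmatrix}\big(\nabla^2\mathcal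 L_I(\lambda^*,\nu^*,y^*\mid x,\sigma)\big)^\dagger\begin{bmatrix}0\\ \nabla_yf(x,y^*)\end{bmatrix}.$$ If $\sigma=0$ (so that $\partial/\partial\sigma$ is the right derivative), then moreover $\psi(x)=\min\{f(x,y): y\in\arg\min_{z\in Y}g(x,z)\}$ is differentiable at $x$, its gradient being the vector above; the functions $\psi_s(x)=\big(l(x,s)-l(x,0)\big)/s$ are differentiable at $x$ for all small $s>0$; and $\lim_{s\to0^+}\nabla\psi_s(x)=\nabla\psi(x)$. -/

import Mathlib

open Set Filter Topology

namespace BilevelPenalty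

noncomputable section

/-- Matrix of second derivatives of a real function on `ℝ^ι`. -/
def hessianMatrix {ι : Type*} [Fintype ι] [DecidableEq ι]
    (φ : EuclideanSpace ℝ ι → ℝ) (z : EuclideanSpace ℝ ι) : Matrix ι ι ℝ :=
  Matrix.of fun i j =>
    fderiv ℝ (fun z' => fderiv ℝ φ z' (EuclideanSpace.single j 1)) z (EuclideanSpace.single i 1)

/-- The mixed matrix `∇²_{xy} φ(x, y)`, with entry `∂_{x_i} ∂_{y_j} φ` in row `i`, column `j`. -/
def crossHessian {ι κ : Type*} [Fintype ι] [DecidableEq ι] [Fintype κ] [DecidableEq κ]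
    (φ : EuclideanSpace ℝ ι → EuclideanSpace ℝ κ → ℝ)
    (x : EuclideanSpace ℝ ι) (y : EuclideanSpace ℝ κ) : Matrix ι κ ℝ :=
  Matrix.of fun i j =>
    fderiv ℝ (fun x' => fderiv ℝ (φ x') y (EuclideanSpace.single j 1)) x
      (EuclideanSpace.single i 1)

/-- The pseudo-inverse `U (Uᵀ M U)⁻¹ Uᵀ` of a symmetric real matrix `M`, where the columns of `U`
are the vectors of an orthonormal eigenbasis of `M` that belong to non-zero eigenvalues. -/
def pinv {ι : Type*} [Fintype ι] [DecidableEq ι] (M : Matrix ι ι ℝ) : Matrix ι ι ℝ :=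
  if h : M.IsHermitian then
    let U : Matrix ι {i : ι // h.eigenvalues i ≠ 0} ℝ :=
      (h.eigenvectorUnitary : Matrix ι ι ℝ).submatrix id Subtype.val
    U * (U.transpose * M * U)⁻¹ * U.transpose
  else 0

/-- Finitely many convex `C²` inequality constraints and affine equality constraints on `ℝ^d`. -/
structure ConstraintSystem (d m₁ m₂ : ℕ) where
  ineq : Fin m₁ → EuclideanSpace ℝ (Fin d) → ℝ
  eqn : Fin m₂ → (EuclideanSpace ℝ (Fin d) →ᵃ[ℝ] ℝ)
  convexOn_ineq : ∀ i, ConvexOn ℝ univ (ineq i)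
  contDiff_ineq : ∀ i, ContDiff ℝ 2 (ineq i)

/-- The set cut out by the constraints. -/
def ConstraintSystem.feasible {d m₁ m₂ : ℕ} (c : ConstraintSystem d m₁ m₂) :
    Set (EuclideanSpace ℝ (Fin d)) :=
  {y | (∀ i, c.ineq i y ≤ 0) ∧ ∀ j, c.eqn j y = 0}

/-- Indices of the inequality constraints that are active at `y`. -/
def ConstraintSystem.active {d m₁ m₂ : ℕ} (c : ConstraintSystem d m₁ m₂)
    (y : EuclideanSpace ℝ (Fin d)) : Finset (Fin m₁) :=
  Finset.univ.filter fun i => c.ineq i y = 0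

/-- Linear independence constraint qualification. -/
def ConstraintSystem.LICQ {d m₁ m₂ : ℕ} (c : ConstraintSystem d m₁ m₂)
    (y : EuclideanSpace ℝ (Fin d)) : Prop :=
  LinearIndependent ℝ
    (Sum.elim (fun i : c.active y => gradient (c.ineq i) y)
      (fun j : Fin m₂ => gradient (c.eqn j) y))

section Parametric

variable {P : Type*} {d m₁ m₂ : ℕ}

/-- `min_{θ ∈ Θ} F(w, θ)`. -/
def valueFn (F : P → EuclideanSpace ℝ (Fin d) → ℝ) (Θ : Set (EuclideanSpace ℝ (Fin d)))
    (w : P) : ℝ :=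
  sInf (F w '' Θ)

/-- `argmin_{θ ∈ Θ} F(w, θ)`. -/
def solutionSet (F : P → EuclideanSpace ℝ (Fin d) → ℝ) (Θ : Set (EuclideanSpace ℝ (Fin d)))
    (w : P) : Set (EuclideanSpace ℝ (Fin d)) :=
  {θ | θ ∈ Θ ∧ ∀ θ' ∈ Θ, F w θ ≤ F w θ'}

/-- The set-valued map `S` on `W` is locally Lipschitz at the point `w`, in Hausdorff distance.
(Passing to an equivalent metric on `P` does not change this notion.) -/
def LocLipschitzAt [PseudoMetricSpace P] (S : P → Set (EuclideanSpace ℝ (Fin d)))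
    (W : Set P) (w : P) : Prop :=
  ∃ δ > 0, ∃ L : ℝ, ∀ w' ∈ W, dist w' w < δ →
    Metric.hausdorffEDist (S w) (S w') ≤ ENNReal.ofReal (L * dist w' w)

/-- The space of triples `(λ_I, ν, θ)`. -/
abbrev PrimalDual (I : Finset (Fin m₁)) (m₂ d : ℕ) : Type :=
  EuclideanSpace ℝ ((I ⊕ Fin m₂) ⊕ Fin d)

/-- The triple `(λ_I, ν, θ)` as one vector. -/
def primalDual {I : Finset (Fin m₁)} (lam : I → ℝ) (nu : Fin m₂ → ℝ)
    (θ : EuclideanSpace ℝ (Fin d)) : PrimalDual I m₂ d :=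
  WithLp.toLp 2 (Sum.elim (Sum.elim lam nu) (fun k => θ k))

/-- The component `θ` of `(λ_I, ν, θ)`. -/
def primalPart {I : Finset (Fin m₁)} (z : PrimalDual I m₂ d) : EuclideanSpace ℝ (Fin d) :=
  WithLp.toLp 2 (fun k => z (Sum.inr k))

/-- The Lagrangian `L_I(λ_I, ν, θ | w)` restricted to the inequality constraints in `I`. -/
def lagrangian (c : ConstraintSystem d m₁ m₂) (F : P → EuclideanSpace ℝ (Fin d) → ℝ)
    (I : Finset (Fin m₁)) (w : P) (z : PrimalDual I m₂ d) : ℝ :=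
  F w (primalPart z)
    + ∑ i : I, z (Sum.inl (Sum.inl i)) * c.ineq i (primalPart z)
    + ∑ j : Fin m₂, z (Sum.inl (Sum.inr j)) * c.eqn j (primalPart z)

/-- `θ` minimises `F(w, ·)` over the feasible set, LICQ and strict complementarity hold at `θ` with
multipliers `lam`, `nu`, and the Lagrangian restricted to the constraints active at `θ` is twice
differentiable near `(w, lam, nu, θ)`, with second derivative continuous at that point. -/
structure IsRegularSolution [NormedAddCommGroup P] [NormedSpace ℝ P]
    (c : ConstraintSystem d m₁ m₂) (F : P → EuclideanSpace ℝ (Fin d) → ℝ) (w : P)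
    (θ : EuclideanSpace ℝ (Fin d)) (lam : c.active θ → ℝ) (nu : Fin m₂ → ℝ) : Prop where
  mem_solutionSet : θ ∈ solutionSet F c.feasible w
  licq : c.LICQ θ
  stationary : gradient (F w) θ + ∑ i : c.active θ, lam i • gradient (c.ineq i) θ
    + ∑ j : Fin m₂, nu j • gradient (c.eqn j) θ = 0
  lam_pos : ∀ i, 0 < lam i
  twice_differentiable : ∀ᶠ p in 𝓝 (w, primalDual lam nu θ),
    DifferentiableAt ℝ (fderiv ℝ fun q : P × PrimalDual (c.active θ) m₂ d =>
      lagrangian c F (c.active θ) q.1 q.2) p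
  hessian_continuous : ContinuousAt
    (fderiv ℝ (fderiv ℝ fun q : P × PrimalDual (c.active θ) m₂ d =>
      lagrangian c F (c.active θ) q.1 q.2)) (w, primalDual lam nu θ)

/-- The matrix `∇² L_I(λ, ν, θ | w)` of second derivatives in all of `(λ_I, ν, θ)`, where `I` is
the set of constraints active at `θ`. -/
def lagrangianHessian (c : ConstraintSystem d m₁ m₂) (F : P → EuclideanSpace ℝ (Fin d) → ℝ)
    (w : P) (θ : EuclideanSpace ℝ (Fin d)) (lam : c.active θ → ℝ) (nu : Fin m₂ → ℝ) :
    Matrix ((c.active θ ⊕ Fin m₂) ⊕ Fin d) ((c.active θ ⊕ Fin m₂) ⊕ Fin d) ℝ :=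
  hessianMatrix (lagrangian c F (c.active θ) w) (primalDual lam nu θ)

/-- `F` is continuously differentiable on an open neighbourhood of `W × Θ`. -/
def SmoothNear [NormedAddCommGroup P] [NormedSpace ℝ P]
    (F : P → EuclideanSpace ℝ (Fin d) → ℝ) (W : Set P)
    (Θ : Set (EuclideanSpace ℝ (Fin d))) : Prop :=
  ∃ U : Set (P × EuclideanSpace ℝ (Fin d)), IsOpen U ∧ W ×ˢ Θ ⊆ U ∧
    ContDiffOn ℝ 1 (Function.uncurry F) U

end Parametric

/-- `∇²_{ww} F - [0, ∇²_{wθ} F] (∇² L_I)^† [0; ∇²_{θw} F]`. -/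
def valueHessian {p d m₁ m₂ : ℕ} (c : ConstraintSystem d m₁ m₂)
    (F : EuclideanSpace ℝ (Fin p) → EuclideanSpace ℝ (Fin d) → ℝ)
    (w : EuclideanSpace ℝ (Fin p)) (θ : EuclideanSpace ℝ (Fin d))
    (lam : c.active θ → ℝ) (nu : Fin m₂ → ℝ) : Matrix (Fin p) (Fin p) ℝ :=
  hessianMatrix (fun w' => F w' θ) w
    - Matrix.fromCols (0 : Matrix (Fin p) (c.active θ ⊕ Fin m₂) ℝ) (crossHessian F w θ)
      * pinv (lagrangianHessian c F w θ lam nu)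
      * Matrix.fromRows (0 : Matrix (c.active θ ⊕ Fin m₂) (Fin p) ℝ)
          (crossHessian (fun θ' w' => F w' θ') θ w)

section Bilevel

variable {n d m₁ m₂ : ℕ}

/-- The perturbed lower-level objective `h_σ(x, y) = σ f(x, y) + g(x, y)`, with parameter
`w = (x, σ)`. -/
def perturbed (f g : EuclideanSpace ℝ (Fin n) → EuclideanSpace ℝ (Fin d) → ℝ)
    (w : EuclideanSpace ℝ (Fin n) × ℝ) (y : EuclideanSpace ℝ (Fin d)) : ℝ :=
  w.2 * f w.1 y + g w.1 y

/-- The value function `l(x, σ) = min_{y ∈ Y} h_σ(x, y)`. -/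
def lowerValue (f g : EuclideanSpace ℝ (Fin n) → EuclideanSpace ℝ (Fin d) → ℝ)
    (Y : Set (EuclideanSpace ℝ (Fin d))) (x : EuclideanSpace ℝ (Fin n)) (σ : ℝ) : ℝ :=
  valueFn (perturbed f g) Y (x, σ)

/-- The hyper-objective `ψ(x) = min {f(x, y) : y ∈ argmin_{z ∈ Y} g(x, z)}`. -/
def hyperObjective (f g : EuclideanSpace ℝ (Fin n) → EuclideanSpace ℝ (Fin d) → ℝ)
    (Y : Set (EuclideanSpace ℝ (Fin d))) (x : EuclideanSpace ℝ (Fin n)) : ℝ :=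
  sInf (f x '' solutionSet g Y x)

/-- The penalised hyper-objective
`ψ_σ(x) = (min_{y ∈ Y} (σ f(x, y) + g(x, y)) - min_{z ∈ Y} g(x, z)) / σ`. -/
def penalized (f g : EuclideanSpace ℝ (Fin n) → EuclideanSpace ℝ (Fin d) → ℝ)
    (Y : Set (EuclideanSpace ℝ (Fin d))) (σ : ℝ) (x : EuclideanSpace ℝ (Fin n)) : ℝ :=
  (lowerValue f g Y x σ - valueFn g Y x) / σ

/-- `∇_x f(x, y) - [0, ∇²_{xy} h_σ(x, y)] (∇² L_I)^† [0; ∇_y f(x, y)]`. -/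
def mixedDerivative (c : ConstraintSystem d m₁ m₂)
    (f g : EuclideanSpace ℝ (Fin n) → EuclideanSpace ℝ (Fin d) → ℝ)
    (x : EuclideanSpace ℝ (Fin n)) (σ : ℝ) (y : EuclideanSpace ℝ (Fin d))
    (lam : c.active y → ℝ) (nu : Fin m₂ → ℝ) : EuclideanSpace ℝ (Fin n) :=
  gradient (fun x' => f x' y) x
    - WithLp.toLp 2
      ((Matrix.fromCols (0 : Matrix (Fin n) (c.active y ⊕ Fin m₂) ℝ)
          (crossHessian (fun x' y' => perturbed f g (x', σ) y') x y)
        * pinv (lagrangianHessian c (perturbed f g) (x, σ) y lam nu)).mulVec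
        (Sum.elim 0 (fun k => gradient (f x) y k)))

end Bilevel

end

end BilevelPenalty

open BilevelPenalty

open Asymptotics

/-! The argument has an envelope step, a stability step for multipliers and a linear-algebra step.

Envelope. Let `y` be any solution at `w`. The Lipschitz hypothesis supplies solutions `ζ(w')` at
nearby `w'` with `‖ζ(w') - y‖ = O(‖w' - w‖)`. Comparing `l(w')` with `F(w', y)` and `l(w)` with
`F(w, ζ(w'))` gives `D l(w) = ∂_w F(w, y)` (`hasFDerivWithinAt_valueFn`). No uniqueness of solutions
is involved, and the value of `∂_w F(w, y)` is the same at every solution.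

Stability (`exists_critical_near`). Near a regular solution the selected solutions have Lagrange
multipliers, since linear independence of the gradients is an open condition. The multipliers solve
a linear system with an injective matrix whose data move by `O(‖w' - w‖)`, so they move by `O(‖w' -
w‖)` too. A constraint that became inactive would have multiplier zero, which is impossible close to
a positive `λ*_i`. Hence all of `I` stays active and the point `z(w') = (λ', ν', y')` is critical
for `L_I(w', ·)`.

Linear algebra (`hasFDerivWithinAt_of_critical`). Write `M` for the Hessian of `L_I` in `z`, `A` for
its mixed derivative, `u = w' - w` and `δ = z(w') - z*`. Linearizing criticality gives `A u + M δ =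
o(‖u‖)`. `M` may be singular, so `δ` need not be determined to first order. However, the relation
forces the range of `A` into the range of `M`, so `⟨A v, δ⟩ = ⟨M N A v, δ⟩ = ⟨N A v, M δ⟩ = -⟨A v, N
A u⟩ + o(‖u‖)` whenever `M N M = M`. This is the correction term in the Hessian of `l`, and the
pseudo-inverse is one such `N`.

For the bilevel form the general argument runs with `w = (x, σ)`, and the two mixed derivatives are
the two off-diagonal values of one symmetric form. At `σ = 0` the envelope formula identifies `ψ`
with the right derivative of `l` in `σ`, and `∇ψ_s` is a difference quotient of `∇_x l(x, ·)`. -/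

namespace BilevelPenalty

/-! ### The pseudo-inverse as a generalized inverse. -/

section PseudoInverse

variable {ι : Type*} [Fintype ι]

/-- The sensitivity argument needs no property of the pseudo-inverse beyond `M N M = M`, which
follows by cancelling `Uᵀ U = 1` inside the product. -/
theorem mul_mul_inv_mul_of_eq {κ : Type*} [Fintype κ] [DecidableEq κ] {M : Matrix ι ι ℝ}
    {U : Matrix ι κ ℝ} {D : Matrix κ κ ℝ} (hU : U.transpose * U = 1) (hD : IsUnit D.det)
    (hM : M = U * D * U.transpose) :
    M * (U * (U.transpose * M * U)⁻¹ * U.transpose) * M = M := by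
  have hUMU : U.transpose * M * U = D := by
    calc U.transpose * M * U = (U.transpose * U) * D * (U.transpose * U) := by
          rw [hM]; simp only [Matrix.mul_assoc]
      _ = D := by rw [hU, Matrix.one_mul, Matrix.mul_one]
  rw [hUMU]
  calc M * (U * D⁻¹ * U.transpose) * M
      = U * (D * (U.transpose * U) * D⁻¹ * (U.transpose * U) * D) * U.transpose := by
        rw [hM]; simp only [Matrix.mul_assoc]
    _ = M := by
        rw [hU, Matrix.mul_one, Matrix.mul_one, Matrix.mul_nonsing_inv _ hD, Matrix.one_mul, hM]

/-- The pseudo-inverse is a generalized inverse. -/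
theorem mul_pinv_mul [DecidableEq ι] {M : Matrix ι ι ℝ} (h : M.IsHermitian) : M * pinv M * M = M := by
  rw [pinv, dif_pos h]
  set V : Matrix ι ι ℝ := (h.eigenvectorUnitary : Matrix ι ι ℝ)
  have hVV : V.transpose * V = 1 := by
    have := (Matrix.mem_unitaryGroup_iff').1 h.eigenvectorUnitary.2
    rwa [Matrix.star_eq_conjTranspose, Matrix.conjTranspose_eq_transpose_of_trivial] at this
  have hs : M = V * Matrix.diagonal h.eigenvalues * V.transpose := by
    conv_lhs => rw [h.spectral_theorem]
    simp only [Unitary.conjStarAlgAut_apply, Matrix.star_eq_conjTranspose,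
      Matrix.conjTranspose_eq_transpose_of_trivial]
    rfl
  refine mul_mul_inv_mul_of_eq
    (D := Matrix.diagonal fun i : {i : ι // h.eigenvalues i ≠ 0} => h.eigenvalues i.1) ?_ ?_ ?_
  · ext i j
    have := congrFun (congrFun hVV i.1) j.1
    simp only [Matrix.mul_apply, Matrix.transpose_apply, Matrix.one_apply] at this ⊢
    simpa [Subtype.ext_iff] using this
  · rw [Matrix.det_diagonal, isUnit_iff_ne_zero]
    exact Finset.prod_ne_zero_iff.2 fun i _ => i.2
  · refine hs.trans (Matrix.ext fun i j => ?_)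
    rw [Matrix.mul_apply, Matrix.mul_apply]
    simp only [Matrix.mul_diagonal, Matrix.transpose_apply, Matrix.submatrix_apply, id]
    -- Null eigenvectors contribute nothing to the spectral sum, so it reduces to the columns of
    -- `U`.
    rw [← Finset.sum_filter_of_ne (p := fun k => h.eigenvalues k ≠ 0)
      (by intro k _ hk h0; simp [h0] at hk)]
    exact Finset.sum_subtype _ (by simp) _

end PseudoInverse

/-! ### The envelope theorem under Lipschitz solution sets. -/

section Danskin

variable {P : Type*} {d : ℕ}

/-- Only one half of the Hausdorff bound is used: a given solution at `w` can be followed to nearby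
parameters with linear error. -/
theorem LocLipschitzAt.exists_norm_sub_le [NormedAddCommGroup P]
    {S : P → Set (EuclideanSpace ℝ (Fin d))} {W : Set P}
    {w : P} (h : LocLipschitzAt S W w) {y : EuclideanSpace ℝ (Fin d)} (hy : y ∈ S w) :
    ∃ C : ℝ, ∀ᶠ w' in 𝓝[W] w, ∃ y' ∈ S w', ‖y' - y‖ ≤ C * ‖w' - w‖ := by
  obtain ⟨δ, hδ, L, hL⟩ := h
  -- A near point can be extracted only from a strict bound on the Hausdorff distance; the extra `1`
  -- makes it strict when `w' ≠ w`.
  refine ⟨|L| + 1, ?_⟩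
  filter_upwards [self_mem_nhdsWithin, mem_nhdsWithin_of_mem_nhds (Metric.ball_mem_nhds w hδ)]
    with w' hw' hd
  rcases eq_or_ne w' w with rfl | hne
  · exact ⟨y, hy, by simp⟩
  have hpos : 0 < ‖w' - w‖ := norm_pos_iff.2 (sub_ne_zero.2 hne)
  have hlt : Metric.hausdorffEDist (S w) (S w') < ENNReal.ofReal ((|L| + 1) * ‖w' - w‖) := by
    refine (hL w' hw' hd).trans_lt ?_
    rw [dist_eq_norm]
    refine (ENNReal.ofReal_lt_ofReal_iff (by positivity)).2 ?_
    exact mul_lt_mul_of_pos_right (by linarith [le_abs_self L]) hpos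
  obtain ⟨y', hy', hlt'⟩ := Metric.exists_edist_lt_of_hausdorffEDist_lt hy hlt
  refine ⟨y', hy', ?_⟩
  rw [edist_comm, edist_dist, ENNReal.ofReal_lt_ofReal_iff (by positivity), dist_eq_norm] at hlt'
  exact hlt'.le

theorem valueFn_eq {F : P → EuclideanSpace ℝ (Fin d) → ℝ} {Y : Set (EuclideanSpace ℝ (Fin d))}
    {w : P} {y : EuclideanSpace ℝ (Fin d)} (hy : y ∈ solutionSet F Y w) :
    valueFn F Y w = F w y :=
  IsLeast.csInf_eq ⟨mem_image_of_mem _ hy.1, by rintro _ ⟨z, hz, rfl⟩; exact hy.2 z hz⟩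

/-- The value function is squeezed between increments of `F` in `w` alone, one with `y` frozen and
one with the nearby solution frozen. Strict differentiability controls both with the same `D`. -/
theorem hasFDerivWithinAt_valueFn [NormedAddCommGroup P] [NormedSpace ℝ P]
    {F : P → EuclideanSpace ℝ (Fin d) → ℝ}
    {Y : Set (EuclideanSpace ℝ (Fin d))} {W : Set P} {w : P} (hwW : w ∈ W)
    (hlip : LocLipschitzAt (solutionSet F Y) W w) {y : EuclideanSpace ℝ (Fin d)}
    (hy : y ∈ solutionSet F Y w) {D : P × EuclideanSpace ℝ (Fin d) →L[ℝ] ℝ}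
    (hD : HasStrictFDerivAt (Function.uncurry F) D (w, y)) :
    HasFDerivWithinAt (valueFn F Y) (D.comp (.inl ℝ _ _)) W w := by
  obtain ⟨C, hC⟩ := hlip.exists_norm_sub_le hy
  have := mem_closure_iff_nhdsWithin_neBot.1 (subset_closure hwW)
  obtain ⟨ζ, hζ⟩ := hC.choice
  have hw : Tendsto (fun w' : P => w') (𝓝[W] w) (𝓝 w) := tendsto_id.mono_left nhdsWithin_le_nhds
  have hζt : Tendsto ζ (𝓝[W] w) (𝓝 y) := by
    rw [tendsto_iff_norm_sub_tendsto_zero]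
    refine squeeze_zero' (Eventually.of_forall fun _ => norm_nonneg _)
      (hζ.mono fun _ h => h.2) ?_
    have : Tendsto (fun w' => C * ‖w' - w‖) (𝓝 w) (𝓝 (C * ‖w - w‖)) :=
      (Continuous.tendsto (by fun_prop) w)
    simpa using this.mono_left nhdsWithin_le_nhds
  rw [hasFDerivWithinAt_iff_isLittleO, isLittleO_iff]
  intro ε hε
  have hs := isLittleO_iff.1 hD.isLittleO hε
  -- `h1` gives the upper bound, since `y` is a competitor at `w'`; `h2` gives the lower bound,
  -- since `ζ w'` is a competitor at `w`.
  have h1 := ((hw.prodMk_nhds tendsto_const_nhds).prodMk_nhds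
    (tendsto_const_nhds (x := (w, y)))).eventually hs
  have h2 := ((hw.prodMk_nhds hζt).prodMk_nhds
    ((tendsto_const_nhds (x := w)).prodMk_nhds hζt)).eventually hs
  filter_upwards [h1, h2, hζ] with w' h1 h2 hz
  have e1 : ((w', y) : P × EuclideanSpace ℝ (Fin d)) - (w, y) = (w' - w, 0) := by simp
  have e2 : ((w', ζ w') : P × EuclideanSpace ℝ (Fin d)) - (w, ζ w') = (w' - w, 0) := by simp
  have e3 : ‖((w' - w, 0) : P × EuclideanSpace ℝ (Fin d))‖ = ‖w' - w‖ := by simp [Prod.norm_def]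
  simp only [e1, e2, e3, Function.uncurry_apply_pair, Real.norm_eq_abs, abs_le] at h1 h2
  have u1 := hz.1.2 y hy.1
  have u2 := hy.2 _ hz.1.1
  rw [valueFn_eq hy, valueFn_eq hz.1, Real.norm_eq_abs, abs_le]
  simp only [ContinuousLinearMap.comp_apply, ContinuousLinearMap.inl_apply]
  constructor <;> linarith [h1.1, h1.2, h2.1, h2.2]

end Danskin

/-! ### Sensitivity along critical points with a possibly singular Hessian. -/

section Sensitivity

variable {E ι : Type*} [NormedAddCommGroup E] [NormedSpace ℝ E] [Fintype ι]

/-- Sensitivity of the partial derivative `D_w Q` along a curve of critical points of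
`Q (w, ·)`, with a generalized inverse `N` in place of the inverse of the Hessian `M`. -/
theorem hasFDerivWithinAt_of_critical {Dq : E × EuclideanSpace ℝ ι → (E × EuclideanSpace ℝ ι →L[ℝ] ℝ)}
    {D2 : E × EuclideanSpace ℝ ι →L[ℝ] E × EuclideanSpace ℝ ι →L[ℝ] ℝ} {w₀ : E} {z₀ : EuclideanSpace ℝ ι} (hD : HasFDerivAt Dq D2 (w₀, z₀))
    (hsymm : ∀ p q, D2 p q = D2 q p) {A : E →L[ℝ] EuclideanSpace ℝ ι} {M N : EuclideanSpace ℝ ι →L[ℝ] EuclideanSpace ℝ ι}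
    (hA : ∀ u z, inner ℝ (A u) z = D2 (u, 0) (0, z))
    (hM : ∀ z z', inner ℝ (M z) z' = D2 (0, z) (0, z')) (hN : ∀ z, M (N (M z)) = M z)
    {W : Set E} (hW : UniqueDiffWithinAt ℝ W w₀) (hw₀ : w₀ ∈ W) {ℓ : E → (E →L[ℝ] ℝ)} {C : ℝ}
    (hcrit : ∀ᶠ w in 𝓝[W] w₀, ∃ z, ‖z - z₀‖ ≤ C * ‖w - w₀‖ ∧
      (∀ v, Dq (w, z) (0, v) = 0) ∧ ∀ u, ℓ w u = Dq (w, z) (u, 0))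
    {H : E →L[ℝ] E →L[ℝ] ℝ}
    (hH : ∀ u v, H u v = D2 (u, 0) (v, 0) - inner ℝ (A v) (N (A u))) :
    HasFDerivWithinAt ℓ H W w₀ := by
  have := mem_closure_iff_nhdsWithin_neBot.1 (subset_closure hw₀)
  obtain ⟨ζ, hζ⟩ := hcrit.choice
  have hζ₀ : ζ w₀ = z₀ := by
    have := (hζ.self_of_nhdsWithin hw₀).1
    simpa [sub_eq_zero] using this
  have hdz : (fun w => ζ w - z₀) =O[𝓝[W] w₀] fun w => w - w₀ :=
    IsBigO.of_bound C (hζ.mono fun _ h => h.1)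
  have hdq : (fun w => (w, ζ w) - (w₀, z₀)) =O[𝓝[W] w₀] fun w => w - w₀ :=
    (isBigO_refl _ _).prod_left hdz
  have hw : Tendsto (fun w : E => w) (𝓝[W] w₀) (𝓝 w₀) := tendsto_id.mono_left nhdsWithin_le_nhds
  have hw0 : Tendsto (fun w : E => w - w₀) (𝓝[W] w₀) (𝓝 0) := by
    simpa using hw.sub_const w₀
  have hq : Tendsto (fun w => (w, ζ w)) (𝓝[W] w₀) (𝓝 (w₀, z₀)) := by
    refine hw.prodMk_nhds ?_
    simpa using (hdz.trans_tendsto hw0).add_const z₀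
  set r : E → (E × EuclideanSpace ℝ ι →L[ℝ] ℝ) := fun w =>
    Dq (w, ζ w) - Dq (w₀, z₀) - D2 ((w, ζ w) - (w₀, z₀)) with hr
  have hro : (fun w => ‖r w‖) =o[𝓝[W] w₀] fun w => w - w₀ := by
    have h1 := hD.isLittleO
    exact ((h1.comp_tendsto hq).trans_isBigO hdq).norm_left
  have hcrit₀ := (hζ.self_of_nhdsWithin hw₀).2.1
  rw [hζ₀] at hcrit₀
  have hsplit : ∀ (u : E) (z : EuclideanSpace ℝ ι) q, D2 (u, z) q = D2 (u, 0) q + D2 (0, z) q := fun u z q => by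
    rw [← add_apply, ← map_add]; simp
  -- the linearized criticality condition
  have hlin : ∀ᶠ w in 𝓝[W] w₀, ∀ v,
      inner ℝ (A (w - w₀) + M (ζ w - z₀)) v = - r w (0, v) := by
    filter_upwards [hζ] with w h v
    rw [inner_add_left, hA, hM, ← hsplit]
    simp only [hr, sub_apply, h.2.1 v, hcrit₀ v, Prod.mk_sub_mk]
    ring
  have hlino : (fun w => A (w - w₀) + M (ζ w - z₀)) =o[𝓝[W] w₀] fun w => w - w₀ := by
    refine IsBigO.trans_isLittleO (IsBigO.of_bound 1 ?_) hro
    filter_upwards [hlin] with w h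
    rw [norm_norm]
    set a := A (w - w₀) + M (ζ w - z₀)
    -- The linearized condition is tested against the residual itself.
    have h1 : ‖a‖ * ‖a‖ ≤ ‖r w‖ * ‖a‖ := by
      rw [← real_inner_self_eq_norm_mul_norm, h a]
      refine (le_abs_self _).trans ?_
      rw [abs_neg, ← Real.norm_eq_abs]
      refine ((r w).le_opNorm _).trans (le_of_eq ?_)
      simp [Prod.norm_def]
    rw [one_mul]
    rcases (norm_nonneg a).eq_or_lt with h0 | h0
    · rw [← h0]; positivity
    · exact le_of_mul_le_mul_right h1 h0
  have hMsymm : ∀ z z', inner ℝ (M z) z' = inner ℝ z (M z') := fun z z' => by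
    rw [hM, hsymm, ← hM, real_inner_comm]
  -- the range of `A` lies in that of `M`
  have hrange : ∀ u, M (N (A u)) = A u := by
    set R : EuclideanSpace ℝ ι →L[ℝ] EuclideanSpace ℝ ι := .id ℝ (EuclideanSpace ℝ ι) - M ∘L N with hR
    have hRM : ∀ z, R (M z) = 0 := fun z => by simp [hR, hN]
    -- Since `R` kills the range of `M`, applying it to the linearized condition leaves `R A (w -
    -- w₀) = o(‖w - w₀‖)`: the zero map has derivative `R ∘L A`, and uniqueness of derivatives gives
    -- `R ∘L A = 0`.
    have h0 : HasFDerivWithinAt (fun _ : E => (0 : EuclideanSpace ℝ ι)) (R ∘L A) W w₀ := by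
      rw [hasFDerivWithinAt_iff_isLittleO]
      refine ((R.isBigO_comp _ _).trans_isLittleO hlino).neg_left.congr_left fun w => ?_
      simp [hRM]
    have h1 := hW.eq h0 (hasFDerivWithinAt_const (0 : EuclideanSpace ℝ ι) w₀ W)
    intro u
    have h2 : R (A u) = 0 := by simpa using congrArg (fun T => T u) h1
    simp only [hR, sub_apply, ContinuousLinearMap.id_apply, ContinuousLinearMap.comp_apply,
      sub_eq_zero] at h2
    exact h2.symm
  rw [hasFDerivWithinAt_iff_isLittleO]
  have hsum : (fun w => ‖N ∘L A‖ * ‖A (w - w₀) + M (ζ w - z₀)‖ + ‖r w‖)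
      =o[𝓝[W] w₀] fun w => w - w₀ := (hlino.norm_left.const_mul_left _).add hro
  refine IsBigO.trans_isLittleO (IsBigO.of_bound 1 ?_) hsum
  have hℓ₀ := (hζ.self_of_nhdsWithin hw₀).2.2
  rw [hζ₀] at hℓ₀
  filter_upwards [hζ] with w h
  rw [one_mul, Real.norm_of_nonneg (by positivity)]
  refine ContinuousLinearMap.opNorm_le_bound _ (by positivity) fun v => ?_
  have key : (ℓ w - ℓ w₀ - H (w - w₀)) v =
      inner ℝ (N (A v)) (A (w - w₀) + M (ζ w - z₀)) + r w (v, 0) := by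
    -- `N` is not assumed symmetric; symmetry of `M` and `M N A = A` suffice.
    have e1 : inner ℝ (N (A v)) (A (w - w₀)) = inner ℝ (A v) (N (A (w - w₀))) := by
      conv_lhs => rw [← hrange (w - w₀), ← hMsymm, hrange]
    have e2 : inner ℝ (N (A v)) (M (ζ w - z₀)) = D2 (0, ζ w - z₀) (v, 0) := by
      rw [← hMsymm, hrange, hA, hsymm]
    rw [inner_add_right, e1, e2]
    simp only [hr, sub_apply, h.2.2 v, hℓ₀ v, hH, Prod.mk_sub_mk]
    rw [hsplit (w - w₀) (ζ w - z₀)]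
    ring
  rw [key, add_mul]
  refine (norm_add_le _ _).trans (add_le_add ?_ ?_)
  · refine (norm_inner_le_norm _ _).trans ?_
    have := (N ∘L A).le_opNorm v
    calc ‖N (A v)‖ * ‖A (w - w₀) + M (ζ w - z₀)‖
        ≤ (‖N ∘L A‖ * ‖v‖) * ‖A (w - w₀) + M (ζ w - z₀)‖ := by gcongr; exact this
      _ = _ := by ring
  · refine ((r w).le_opNorm _).trans (le_of_eq ?_)
    simp [Prod.norm_def]

end Sensitivity

/-! ### Lagrange multipliers and stability of linear independence. -/

section Multipliers

variable {V : Type*} [NormedAddCommGroup V] [NormedSpace ℝ V] {κ : Type*} [Fintype κ]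

theorem exists_multipliers_of_linearIndependent [CompleteSpace V] {φ : V → ℝ}
    {φ' : V →L[ℝ] ℝ} {y : V} {G : κ → V → ℝ} {G' : κ → V →L[ℝ] ℝ}
    (hmin : IsLocalMinOn φ {x | ∀ k, G k x = G k y} y)
    (hG : ∀ k, HasStrictFDerivAt (G k) (G' k) y) (hφ : HasStrictFDerivAt φ φ' y)
    (hli : LinearIndependent ℝ G') : ∃ a : κ → ℝ, φ' + ∑ k, a k • G' k = 0 := by
  obtain ⟨Λ, Λ₀, hne, h⟩ :=
    IsLocalExtrOn.exists_multipliers_of_hasStrictFDerivAt (.inl hmin) hG hφ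
  -- A vanishing multiplier on the objective would be a nontrivial relation among the constraint
  -- gradients.
  have hΛ₀ : Λ₀ ≠ 0 := by
    rintro rfl
    rw [zero_smul, add_zero] at h
    exact hne (Prod.ext (funext (Fintype.linearIndependent_iff.1 hli Λ h)) rfl)
  refine ⟨fun k => Λ₀⁻¹ * Λ k, ?_⟩
  have := congrArg (fun T => Λ₀⁻¹ • T) h
  simp only [smul_add, Finset.smul_sum, smul_smul, inv_mul_cancel₀ hΛ₀, one_smul, smul_zero] at this
  rw [add_comm]
  exact this

/-- Multipliers when only the constraints that vanish at `y` are imposed; the others do not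
contribute. -/
theorem exists_multipliers_supported [CompleteSpace V] {φ : V → ℝ}
    {φ' : V →L[ℝ] ℝ} {y : V} {G : κ → V → ℝ} {G' : κ → V →L[ℝ] ℝ}
    (hmin : IsLocalMinOn φ {x | ∀ k, G k y = 0 → G k x = 0} y)
    (hG : ∀ k, HasStrictFDerivAt (G k) (G' k) y) (hφ : HasStrictFDerivAt φ φ' y)
    (hli : LinearIndependent ℝ G') :
    ∃ a : κ → ℝ, φ' + ∑ k, a k • G' k = 0 ∧ ∀ k, G k y ≠ 0 → a k = 0 := by
  classical
  have hmin' : IsLocalMinOn φ {x | ∀ k : {k // G k y = 0}, G k x = G k y} y := by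
    refine hmin.on_subset fun x hx k hk => ?_
    exact (hx ⟨k, hk⟩).trans hk
  obtain ⟨a, ha⟩ := exists_multipliers_of_linearIndependent hmin' (fun k => hG k) hφ
    (hli.comp _ Subtype.val_injective)
  refine ⟨fun k => if h : G k y = 0 then a ⟨k, h⟩ else 0, ?_, fun k hk => dif_neg hk⟩
  rw [← ha]
  congr 1
  rw [← Finset.sum_filter_of_ne (p := fun k => G k y = 0)
    (by intro k _ hk; by_contra h0; simp [h0] at hk),
    Finset.sum_subtype (p := fun k => G k y = 0) _ (by simp)]
  exact Finset.sum_congr rfl fun k _ => by simp only [dif_pos k.2]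

/-- A linearly independent family stays so, with a uniform lower bound, under perturbation. -/
theorem eventually_norm_le_norm_sum_smul {X : Type*} [TopologicalSpace X] {v : κ → X → V} {x : X}
    (hv : ∀ k, ContinuousAt (v k) x) (hli : LinearIndependent ℝ fun k => v k x) :
    ∃ K : ℝ, ∀ᶠ x' in 𝓝 x, ∀ a : κ → ℝ, ‖a‖ ≤ K * ‖∑ k, a k • v k x'‖ := by
  obtain ⟨K, hK, hanti⟩ := LinearMap.exists_antilipschitzWith
    (Fintype.linearCombination ℝ fun k => v k x)
    (LinearMap.ker_eq_bot.2 hli.fintypeLinearCombination_injective)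
  have hK' : (0 : ℝ) < K := hK
  have hb : ∀ a : κ → ℝ, ‖a‖ ≤ K * ‖∑ k, a k • v k x‖ := fun a => by
    have := hanti.le_mul_dist a 0
    simpa [Fintype.linearCombination_apply] using this
  have ht : Tendsto (fun x' => ∑ k, ‖v k x' - v k x‖) (𝓝 x) (𝓝 0) := by
    have h0 : ∀ k, Tendsto (fun x' => ‖v k x' - v k x‖) (𝓝 x) (𝓝 0) := fun k =>
      tendsto_iff_norm_sub_tendsto_zero.1 (hv k)
    simpa using tendsto_finsetSum Finset.univ fun k _ => h0 k
  -- Once the total perturbation is below `1 / (2 * K)`, it absorbs at most half of `‖a‖`, which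
  -- doubles the constant.
  refine ⟨2 * K, ?_⟩
  filter_upwards [ht.eventually (gt_mem_nhds (show (0 : ℝ) < 1 / (2 * K) by positivity))]
    with x' hx' a
  have h1 : ‖∑ k, a k • v k x‖ ≤ ‖∑ k, a k • v k x'‖ + ‖a‖ * ∑ k, ‖v k x' - v k x‖ := by
    have e : ∑ k, a k • v k x = ∑ k, a k • v k x' - ∑ k, a k • (v k x' - v k x) := by
      rw [← Finset.sum_sub_distrib]
      exact Finset.sum_congr rfl fun k _ => by rw [smul_sub]; abel
    rw [e]
    refine (norm_sub_le _ _).trans (add_le_add le_rfl ?_)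
    rw [Finset.mul_sum]
    refine norm_sum_le_of_le _ fun k _ => ?_
    rw [norm_smul]
    exact mul_le_mul_of_nonneg_right (norm_le_pi_norm a k) (norm_nonneg _)
  have h2 : ‖a‖ * ∑ k, ‖v k x' - v k x‖ ≤ ‖a‖ * (1 / (2 * K)) :=
    mul_le_mul_of_nonneg_left hx'.le (norm_nonneg _)
  have h3 := mul_le_mul_of_nonneg_left (h1.trans (add_le_add le_rfl h2)) hK'.le
  have h4 : (K : ℝ) * (‖∑ k, a k • v k x'‖ + ‖a‖ * (1 / (2 * K))) =
      K * ‖∑ k, a k • v k x'‖ + ‖a‖ / 2 := by field_simp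
  linarith [hb a]

end Multipliers

/-! ### Constraints, primal-dual coordinates and the first derivative of the Lagrangian. -/

section

variable {d m₁ m₂ : ℕ}

/-- The equality constraints together with the inequality constraints in `I`. -/
noncomputable def ConstraintSystem.constraintFn (c : ConstraintSystem d m₁ m₂) (I : Finset (Fin m₁)) :
    I ⊕ Fin m₂ → EuclideanSpace ℝ (Fin d) → ℝ :=
  Sum.elim (fun i => c.ineq i) (fun j => c.eqn j)

theorem ConstraintSystem.contDiff_constraintFn (c : ConstraintSystem d m₁ m₂)
    (I : Finset (Fin m₁)) (k : I ⊕ Fin m₂) : ContDiff ℝ 2 (c.constraintFn I k) := by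
  rcases k with i | j
  · exact c.contDiff_ineq i
  · exact ContinuousAffineMap.contDiff
      (⟨c.eqn j, (c.eqn j).continuous_of_finiteDimensional⟩ : EuclideanSpace ℝ (Fin d) →ᴬ[ℝ] ℝ)

theorem ConstraintSystem.hasStrictFDerivAt_constraintFn (c : ConstraintSystem d m₁ m₂)
    (I : Finset (Fin m₁)) (k : I ⊕ Fin m₂) (y : EuclideanSpace ℝ (Fin d)) :
    HasStrictFDerivAt (c.constraintFn I k) (fderiv ℝ (c.constraintFn I k) y) y :=
  (c.contDiff_constraintFn I k).contDiffAt.hasStrictFDerivAt (by norm_num)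

theorem ConstraintSystem.isCompact_feasible (c : ConstraintSystem d m₁ m₂)
    (hbdd : Bornology.IsBounded c.feasible) : IsCompact c.feasible := by
  refine Metric.isCompact_of_isClosed_isBounded ?_ hbdd
  have h : c.feasible = (⋂ i, {y | c.ineq i y ≤ 0}) ∩ ⋂ j, {y | c.eqn j y = 0} := by
    ext y; simp [ConstraintSystem.feasible]
  rw [h]
  exact (isClosed_iInter fun i => isClosed_le (c.contDiff_ineq i).continuous continuous_const).inter
    (isClosed_iInter fun j =>
      isClosed_eq (c.eqn j).continuous_of_finiteDimensional continuous_const)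

theorem ConstraintSystem.LICQ.linearIndependent_fderiv {c : ConstraintSystem d m₁ m₂}
    {y : EuclideanSpace ℝ (Fin d)} (h : c.LICQ y) :
    LinearIndependent ℝ fun k => fderiv ℝ (c.constraintFn (c.active y) k) y := by
  have h' := h.map' (InnerProductSpace.toDual ℝ (EuclideanSpace ℝ (Fin d))).toLinearEquiv.toLinearMap
    (LinearEquiv.ker _)
  have e : (fun k => fderiv ℝ (c.constraintFn (c.active y) k) y) =
      InnerProductSpace.toDual ℝ (EuclideanSpace ℝ (Fin d)) ∘
        Sum.elim (fun i : c.active y => gradient (c.ineq i) y) fun j => gradient (c.eqn j) y := by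
    funext k
    rcases k with i | j <;> simp [gradient, ConstraintSystem.constraintFn]
  rw [e]
  exact h'

variable {I : Finset (Fin m₁)}

/-- `primalPart` as a continuous linear map. -/
noncomputable def primalPartL (I : Finset (Fin m₁)) (m₂ d : ℕ) :
    PrimalDual I m₂ d →L[ℝ] EuclideanSpace ℝ (Fin d) :=
  LinearMap.toContinuousLinearMap
    { toFun := primalPart, map_add' := fun _ _ => rfl, map_smul' := fun _ _ => rfl }

/-- The inclusion of the primal variables. -/
noncomputable def primalIncl (I : Finset (Fin m₁)) (m₂ d : ℕ) :
    EuclideanSpace ℝ (Fin d) →L[ℝ] PrimalDual I m₂ d :=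
  LinearMap.toContinuousLinearMap
    { toFun := fun y => WithLp.toLp 2 (Sum.elim 0 y)
      map_add' := fun _ _ => by ext (k | k) <;> simp
      map_smul' := fun _ _ => by ext (k | k) <;> simp }

/-- The inclusion of the dual variables. -/
noncomputable def dualIncl (I : Finset (Fin m₁)) (m₂ d : ℕ) :
    (I ⊕ Fin m₂ → ℝ) →L[ℝ] PrimalDual I m₂ d :=
  LinearMap.toContinuousLinearMap
    { toFun := fun a => WithLp.toLp 2 (Sum.elim a 0)
      map_add' := fun _ _ => by ext (k | k) <;> simp
      map_smul' := fun _ _ => by ext (k | k) <;> simp }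

@[simp] theorem primalPartL_apply (z : PrimalDual I m₂ d) :
    primalPartL I m₂ d z = primalPart z := rfl

@[simp] theorem primalIncl_apply_inl (y : EuclideanSpace ℝ (Fin d)) (k : I ⊕ Fin m₂) :
    primalIncl I m₂ d y (Sum.inl k) = 0 := rfl

@[simp] theorem primalIncl_apply_inr (y : EuclideanSpace ℝ (Fin d)) (k : Fin d) :
    primalIncl I m₂ d y (Sum.inr k) = y k := rfl

@[simp] theorem dualIncl_apply_inl (a : I ⊕ Fin m₂ → ℝ) (k : I ⊕ Fin m₂) :
    dualIncl I m₂ d a (Sum.inl k) = a k := rfl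

@[simp] theorem dualIncl_apply_inr (a : I ⊕ Fin m₂ → ℝ) (k : Fin d) :
    dualIncl I m₂ d a (Sum.inr k) = 0 := rfl

@[simp] theorem primalPart_primalIncl (y : EuclideanSpace ℝ (Fin d)) :
    primalPart (primalIncl I m₂ d y) = y := rfl

@[simp] theorem primalPart_dualIncl (a : I ⊕ Fin m₂ → ℝ) :
    primalPart (dualIncl I m₂ d a) = 0 := rfl

@[simp] theorem primalPart_zero : primalPart (0 : PrimalDual I m₂ d) = 0 := rfl

@[simp] theorem primalPart_add (z z' : PrimalDual I m₂ d) :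
    primalPart (z + z') = primalPart z + primalPart z' := rfl

theorem primalDual_eq (lam : I → ℝ) (nu : Fin m₂ → ℝ) (θ : EuclideanSpace ℝ (Fin d)) :
    primalDual lam nu θ = dualIncl I m₂ d (Sum.elim lam nu) + primalIncl I m₂ d θ := by
  ext (k | k) <;> simp [primalDual]

theorem single_inr (k : Fin d) :
    (EuclideanSpace.single (Sum.inr k) 1 : PrimalDual I m₂ d) =
      primalIncl I m₂ d (EuclideanSpace.single k 1) := by
  ext (j | j) <;> simp

section Lagrangian

variable {P : Type*} {c : ConstraintSystem d m₁ m₂} {F : P → EuclideanSpace ℝ (Fin d) → ℝ}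

theorem lagrangian_eq (w : P) (z : PrimalDual I m₂ d) :
    lagrangian c F I w z =
      F w (primalPart z) + ∑ k, z (Sum.inl k) * c.constraintFn I k (primalPart z) := by
  rw [lagrangian, Fintype.sum_sum_type, add_assoc]
  rfl

variable [NormedAddCommGroup P] [NormedSpace ℝ P]

theorem hasFDerivAt_lagrangian {w : P} {z : PrimalDual I m₂ d}
    (hF : DifferentiableAt ℝ (Function.uncurry F) (w, primalPart z)) :
    HasFDerivAt (fun q : P × PrimalDual I m₂ d => lagrangian c F I q.1 q.2)
      ((fderiv ℝ (Function.uncurry F) (w, primalPart z)).comp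
          ((ContinuousLinearMap.fst ℝ P _).prod ((primalPartL I m₂ d).comp (.snd ℝ P _))) +
        ∑ k, (z (Sum.inl k) • (fderiv ℝ (c.constraintFn I k) (primalPart z)).comp
            ((primalPartL I m₂ d).comp (.snd ℝ P _)) +
          c.constraintFn I k (primalPart z) •
            (EuclideanSpace.proj (Sum.inl k) : PrimalDual I m₂ d →L[ℝ] ℝ).comp (.snd ℝ P _)))
      (w, z) := by
  simp only [lagrangian_eq]
  have hπ : HasFDerivAt (fun q : P × PrimalDual I m₂ d => primalPart q.2)
      ((primalPartL I m₂ d).comp (.snd ℝ P _)) (w, z) :=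
    ((primalPartL I m₂ d).comp (.snd ℝ P _)).hasFDerivAt
  refine HasFDerivAt.add ?_ (HasFDerivAt.fun_sum fun k _ => ?_)
  · exact HasFDerivAt.comp (w, z) (g := Function.uncurry F)
      (f := fun q : P × PrimalDual I m₂ d => (q.1, primalPart q.2)) hF.hasFDerivAt
      (hasFDerivAt_fst.prodMk hπ)
  · have h1 : HasFDerivAt (fun q : P × PrimalDual I m₂ d => q.2 (Sum.inl k))
        ((EuclideanSpace.proj (Sum.inl k) : PrimalDual I m₂ d →L[ℝ] ℝ).comp (.snd ℝ P _)) (w, z) :=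
      ((EuclideanSpace.proj (Sum.inl k) : PrimalDual I m₂ d →L[ℝ] ℝ).comp
        (.snd ℝ P _)).hasFDerivAt
    have h2 : HasFDerivAt (fun q : P × PrimalDual I m₂ d => c.constraintFn I k (primalPart q.2))
        ((fderiv ℝ (c.constraintFn I k) (primalPart z)).comp
            ((primalPartL I m₂ d).comp (.snd ℝ P _))) (w, z) :=
      HasFDerivAt.comp (w, z) (g := c.constraintFn I k)
        (f := fun q : P × PrimalDual I m₂ d => primalPart q.2)
        (c.hasStrictFDerivAt_constraintFn I k (primalPart z)).hasFDerivAt hπ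
    exact h1.mul h2

theorem fderiv_lagrangian_apply {w : P} {z : PrimalDual I m₂ d}
    (hF : DifferentiableAt ℝ (Function.uncurry F) (w, primalPart z)) (u : P)
    (ζ : PrimalDual I m₂ d) :
    fderiv ℝ (fun q : P × PrimalDual I m₂ d => lagrangian c F I q.1 q.2) (w, z) (u, ζ) =
      fderiv ℝ (Function.uncurry F) (w, primalPart z) (u, primalPart ζ) +
        ∑ k, (z (Sum.inl k) * fderiv ℝ (c.constraintFn I k) (primalPart z) (primalPart ζ) +
          c.constraintFn I k (primalPart z) * ζ (Sum.inl k)) := by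
  rw [(hasFDerivAt_lagrangian hF).fderiv]
  simp

theorem fderiv_uncurry_right {w : P} {y : EuclideanSpace ℝ (Fin d)}
    (hF : DifferentiableAt ℝ (Function.uncurry F) (w, y)) (v : EuclideanSpace ℝ (Fin d)) :
    fderiv ℝ (F w) y v = fderiv ℝ (Function.uncurry F) (w, y) (0, v) := by
  have h : HasFDerivAt (F w) ((fderiv ℝ (Function.uncurry F) (w, y)).comp (.inr ℝ P _)) y :=
    HasFDerivAt.comp (g := Function.uncurry F) (f := fun y => (w, y)) y hF.hasFDerivAt
      (hasFDerivAt_prodMk_right w y)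
  rw [h.fderiv]; simp

theorem fderiv_uncurry_left {w : P} {y : EuclideanSpace ℝ (Fin d)}
    (hF : DifferentiableAt ℝ (Function.uncurry F) (w, y)) :
    fderiv ℝ (fun w' => F w' y) w = (fderiv ℝ (Function.uncurry F) (w, y)).comp (.inl ℝ P _) := by
  have h : HasFDerivAt (fun w' => F w' y)
      ((fderiv ℝ (Function.uncurry F) (w, y)).comp (.inl ℝ P _)) w :=
    HasFDerivAt.comp (g := Function.uncurry F) (f := fun w' => (w', y)) w hF.hasFDerivAt
      (hasFDerivAt_prodMk_left w y)
  exact h.fderiv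

theorem SmoothNear.eventually_contDiffAt {W : Set P} {Y : Set (EuclideanSpace ℝ (Fin d))}
    (hF : SmoothNear F W Y) {w : P} (hw : w ∈ W) {y : EuclideanSpace ℝ (Fin d)} (hy : y ∈ Y) :
    ∀ᶠ p in 𝓝 (w, y), ContDiffAt ℝ 1 (Function.uncurry F) p := by
  obtain ⟨U, hU, hsub, hc⟩ := hF
  filter_upwards [hU.mem_nhds (hsub ⟨hw, hy⟩)] with p hp
  exact hc.contDiffAt (hU.mem_nhds hp)

theorem SmoothNear.nonempty_solutionSet {W : Set P} {Y : Set (EuclideanSpace ℝ (Fin d))}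
    (hF : SmoothNear F W Y) (hY : IsCompact Y) (hne : Y.Nonempty) {w : P} (hw : w ∈ W) :
    (solutionSet F Y w).Nonempty := by
  obtain ⟨y, hy, hmin⟩ := hY.exists_isMinOn hne (f := F w) fun y hy =>
    ((hF.eventually_contDiffAt hw hy).self_of_nhds.continuousAt.comp
      (f := fun y => (w, y)) (by fun_prop)).continuousWithinAt
  exact ⟨y, hy, fun z hz => hmin hz⟩

end Lagrangian

end

/-! ### Second derivatives and critical points of the Lagrangian near a regular solution. -/

section

variable {d m₁ m₂ : ℕ} {P : Type*} [NormedAddCommGroup P] [NormedSpace ℝ P]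
  {c : ConstraintSystem d m₁ m₂} {F : P → EuclideanSpace ℝ (Fin d) → ℝ} {w : P}
  {θ : EuclideanSpace ℝ (Fin d)} {lam : c.active θ → ℝ} {nu : Fin m₂ → ℝ}

theorem ConstraintSystem.constraintFn_active_eq_zero
    (hθ : θ ∈ c.feasible) (k : c.active θ ⊕ Fin m₂) : c.constraintFn (c.active θ) k θ = 0 := by
  rcases k with i | j
  · exact (Finset.mem_filter.1 i.2).2
  · exact hθ.2 j

/-- The second derivative of the Lagrangian in all of `(w, λ_I, ν, θ)`. -/
noncomputable def lagrangianSecondDeriv (c : ConstraintSystem d m₁ m₂)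
    (F : P → EuclideanSpace ℝ (Fin d) → ℝ) (w : P)
    (θ : EuclideanSpace ℝ (Fin d)) (lam : c.active θ → ℝ) (nu : Fin m₂ → ℝ) :
    P × PrimalDual (c.active θ) m₂ d →L[ℝ] P × PrimalDual (c.active θ) m₂ d →L[ℝ] ℝ :=
  fderiv ℝ (fderiv ℝ fun q : P × PrimalDual (c.active θ) m₂ d =>
    lagrangian c F (c.active θ) q.1 q.2) (w, primalDual lam nu θ)

@[simp] theorem primalPart_primalDual {I : Finset (Fin m₁)} (lam : I → ℝ) (nu : Fin m₂ → ℝ)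
    (y : EuclideanSpace ℝ (Fin d)) : primalPart (primalDual lam nu y) = y := rfl

namespace IsRegularSolution

theorem hasFDerivAt_fderiv (h : IsRegularSolution c F w θ lam nu) :
    HasFDerivAt (fderiv ℝ fun q : P × PrimalDual (c.active θ) m₂ d =>
      lagrangian c F (c.active θ) q.1 q.2) (lagrangianSecondDeriv c F w θ lam nu)
      (w, primalDual lam nu θ) :=
  h.twice_differentiable.self_of_nhds.hasFDerivAt

theorem fderiv_stationary (h : IsRegularSolution c F w θ lam nu) (v : EuclideanSpace ℝ (Fin d)) :
    fderiv ℝ (F w) θ v + ∑ k, Sum.elim lam nu k *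
      fderiv ℝ (c.constraintFn (c.active θ) k) θ v = 0 := by
  have := congrArg (fun g => inner ℝ g v) h.stationary
  simpa [inner_add_left, sum_inner, inner_smul_left, gradient, add_assoc,
    ConstraintSystem.constraintFn] using this

/-- Second-order smoothness is assumed of the Lagrangian only. Second derivatives of `F` are read
off by restricting the Lagrangian's gradient to a path `p` through the base point. -/
theorem hasFDerivAt_fderiv_comp (h : IsRegularSolution c F w θ lam nu) {X : Type*}
    [NormedAddCommGroup X] [NormedSpace ℝ X] {p : X → P × PrimalDual (c.active θ) m₂ d}
    {p' : X →L[ℝ] P × PrimalDual (c.active θ) m₂ d} {x : X} (hp : HasFDerivAt p p' x)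
    (hx : p x = (w, primalDual lam nu θ)) (q : P × PrimalDual (c.active θ) m₂ d) :
    HasFDerivAt (fun x' => fderiv ℝ (fun q : P × PrimalDual (c.active θ) m₂ d =>
      lagrangian c F (c.active θ) q.1 q.2) (p x') q)
      (((lagrangianSecondDeriv c F w θ lam nu).flip q).comp p') x := by
  have h1 := h.hasFDerivAt_fderiv
  rw [← hx] at h1
  exact (ContinuousLinearMap.apply ℝ ℝ q).hasFDerivAt.comp x (h1.comp x hp)

theorem secondDeriv_symm (h : IsRegularSolution c F w θ lam nu)
    (hF : ∀ᶠ p in 𝓝 (w, θ), DifferentiableAt ℝ (Function.uncurry F) p)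
    (p q : P × PrimalDual (c.active θ) m₂ d) :
    lagrangianSecondDeriv c F w θ lam nu p q = lagrangianSecondDeriv c F w θ lam nu q p := by
  refine second_derivative_symmetric_of_eventually
    (f := fun q : P × PrimalDual (c.active θ) m₂ d => lagrangian c F (c.active θ) q.1 q.2)
    ?_ h.hasFDerivAt_fderiv p q
  have ht : Tendsto (fun q : P × PrimalDual (c.active θ) m₂ d => (q.1, primalPartL _ _ _ q.2))
      (𝓝 (w, primalDual lam nu θ)) (𝓝 (w, θ)) :=
    Continuous.tendsto (by fun_prop) (w, primalDual lam nu θ)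
  filter_upwards [ht.eventually hF] with q hq
  exact (hasFDerivAt_lagrangian hq).differentiableAt.hasFDerivAt

/-- The derivative of the Lagrangian in a multiplier is the constraint value, which does not depend
on `w`. This is the zero block in the formulas. -/
theorem secondDeriv_left_dual (h : IsRegularSolution c F w θ lam nu)
    (hF : ∀ᶠ p in 𝓝 (w, θ), DifferentiableAt ℝ (Function.uncurry F) p) (u : P)
    (k : c.active θ ⊕ Fin m₂) :
    lagrangianSecondDeriv c F w θ lam nu (u, 0) (0, EuclideanSpace.single (Sum.inl k) 1) = 0 := by
  have h1 := h.hasFDerivAt_fderiv_comp (hasFDerivAt_prodMk_left w (primalDual lam nu θ)) rfl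
    (0, EuclideanSpace.single (Sum.inl k) 1)
  have ht : Tendsto (fun w' : P => (w', θ)) (𝓝 w) (𝓝 (w, θ)) :=
    Continuous.tendsto (by fun_prop) w
  have h2 := h1.congr_of_eventuallyEq (f₁ := fun _ => (0 : ℝ)) (by
    filter_upwards [ht.eventually hF] with w' hw'
    have hz : primalPart (EuclideanSpace.single (Sum.inl k) 1 : PrimalDual (c.active θ) m₂ d) = 0 := by
      ext j; simp [primalPart]
    rw [fderiv_lagrangian_apply hw', hz]
    simp [Prod.mk_zero_zero,
      ConstraintSystem.constraintFn_active_eq_zero h.mem_solutionSet.1])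
  simpa using congrArg (fun T => T u) (h2.unique (hasFDerivAt_const (0 : ℝ) w))

/-- The second derivative in `w` with `θ` fixed. -/
theorem hasFDerivAt_fderiv_left (h : IsRegularSolution c F w θ lam nu)
    (hF : ∀ᶠ p in 𝓝 (w, θ), DifferentiableAt ℝ (Function.uncurry F) p) (v : P) :
    HasFDerivAt (fun w' => fderiv ℝ (fun w'' => F w'' θ) w' v)
      (((lagrangianSecondDeriv c F w θ lam nu).flip (v, 0)).comp (.inl ℝ _ _)) w := by
  have h1 := h.hasFDerivAt_fderiv_comp (hasFDerivAt_prodMk_left w (primalDual lam nu θ)) rfl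
    (v, 0)
  have ht : Tendsto (fun w' : P => (w', θ)) (𝓝 w) (𝓝 (w, θ)) :=
    Continuous.tendsto (by fun_prop) w
  refine h1.congr_of_eventuallyEq ?_
  filter_upwards [ht.eventually hF] with w' hw'
  rw [fderiv_lagrangian_apply hw', fderiv_uncurry_left hw']
  simp

/-- The derivative in `w` of `∇_θ F`. -/
theorem hasFDerivAt_fderiv_right (h : IsRegularSolution c F w θ lam nu)
    (hF : ∀ᶠ p in 𝓝 (w, θ), DifferentiableAt ℝ (Function.uncurry F) p)
    (v : EuclideanSpace ℝ (Fin d)) :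
    HasFDerivAt (fun w' => fderiv ℝ (F w') θ v)
      (((lagrangianSecondDeriv c F w θ lam nu).flip (0, primalIncl _ _ _ v)).comp (.inl ℝ _ _))
      w := by
  have h1 := h.hasFDerivAt_fderiv_comp (hasFDerivAt_prodMk_left w (primalDual lam nu θ)) rfl
    (0, primalIncl _ _ _ v)
  have ht : Tendsto (fun w' : P => (w', θ)) (𝓝 w) (𝓝 (w, θ)) :=
    Continuous.tendsto (by fun_prop) w
  -- With multipliers and `θ` fixed, the constraint part of the gradient in `θ` is constant in `w'`.
  refine (h1.sub_const (∑ k, Sum.elim lam nu k *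
    fderiv ℝ (c.constraintFn (c.active θ) k) θ v)).congr_of_eventuallyEq ?_
  filter_upwards [ht.eventually hF] with w' hw'
  rw [fderiv_lagrangian_apply hw', fderiv_uncurry_right hw']
  simp [primalDual_eq]

/-- The derivative in `θ` of `∇_w F`. -/
theorem hasFDerivAt_fderiv_left_right (h : IsRegularSolution c F w θ lam nu)
    (hF : ∀ᶠ p in 𝓝 (w, θ), DifferentiableAt ℝ (Function.uncurry F) p) (u : P) :
    HasFDerivAt (fun θ' => fderiv ℝ (fun w' => F w' θ') w u)
      (((lagrangianSecondDeriv c F w θ lam nu).flip (u, 0)).comp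
        ((ContinuousLinearMap.inr ℝ _ _).comp (primalIncl _ _ _))) θ := by
  have hp : HasFDerivAt (fun θ' => (w, primalDual (I := c.active θ) lam nu θ'))
      ((ContinuousLinearMap.inr ℝ P _).comp (primalIncl _ _ _)) θ := by
    simp only [primalDual_eq]
    exact (hasFDerivAt_prodMk_right w _).comp θ ((primalIncl _ _ _).hasFDerivAt.const_add _)
  refine (h.hasFDerivAt_fderiv_comp hp rfl (u, 0)).congr_of_eventuallyEq ?_
  have ht : Tendsto (fun θ' => (w, θ')) (𝓝 θ) (𝓝 (w, θ)) :=
    Continuous.tendsto (by fun_prop) θ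
  filter_upwards [ht.eventually hF] with θ' hθ'
  rw [fderiv_lagrangian_apply hθ', fderiv_uncurry_left hθ']
  simp

theorem lagrangianHessian_apply (h : IsRegularSolution c F w θ lam nu)
    (hF : ∀ᶠ p in 𝓝 (w, θ), DifferentiableAt ℝ (Function.uncurry F) p)
    (i j : (c.active θ ⊕ Fin m₂) ⊕ Fin d) :
    lagrangianHessian c F w θ lam nu i j =
      lagrangianSecondDeriv c F w θ lam nu (0, EuclideanSpace.single i 1)
        (0, EuclideanSpace.single j 1) := by
  have h1 := h.hasFDerivAt_fderiv_comp (hasFDerivAt_prodMk_right w (primalDual lam nu θ)) rfl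
    (0, EuclideanSpace.single j 1)
  have ht : Tendsto (fun z : PrimalDual (c.active θ) m₂ d => (w, primalPartL _ _ _ z))
      (𝓝 (primalDual lam nu θ)) (𝓝 (w, θ)) :=
    Continuous.tendsto (by fun_prop) (primalDual lam nu θ)
  have h2 := h1.congr_of_eventuallyEq (f₁ := fun z =>
      fderiv ℝ (lagrangian c F (c.active θ) w) z (EuclideanSpace.single j 1)) (by
    filter_upwards [ht.eventually hF] with z hz
    have h3 := HasFDerivAt.comp z (f := fun z => (w, z))
      (hasFDerivAt_lagrangian (c := c) (I := c.active θ) hz).differentiableAt.hasFDerivAt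
      (hasFDerivAt_prodMk_right w z)
    change fderiv ℝ ((fun q : P × PrimalDual (c.active θ) m₂ d =>
      lagrangian c F (c.active θ) q.1 q.2) ∘ fun z => (w, z)) z _ = _
    rw [h3.fderiv]
    simp)
  rw [lagrangianHessian, hessianMatrix, Matrix.of_apply, h2.fderiv]
  simp

/-- Near `w` there are points `(λ', ν', θ')` with `θ'` a solution at which the Lagrangian is
critical, at a distance of order `‖w' - w‖`. -/
theorem exists_critical_near (h : IsRegularSolution c F w θ lam nu)
    {W : Set P} (hw : w ∈ W)
    (hF1 : ∀ᶠ p in 𝓝 (w, θ), ContDiffAt ℝ 1 (Function.uncurry F) p)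
    (hlip : LocLipschitzAt (solutionSet F c.feasible) W w) :
    ∃ C : ℝ, ∀ᶠ w' in 𝓝[W] w, ∃ z : PrimalDual (c.active θ) m₂ d,
      ‖z - primalDual lam nu θ‖ ≤ C * ‖w' - w‖ ∧
      primalPart z ∈ solutionSet F c.feasible w' ∧
      DifferentiableAt ℝ (Function.uncurry F) (w', primalPart z) ∧
      ∀ ζ, fderiv ℝ (fun q : P × PrimalDual (c.active θ) m₂ d =>
        lagrangian c F (c.active θ) q.1 q.2) (w', z) (0, ζ) = 0 := by
  have hF : ∀ᶠ p in 𝓝 (w, θ), DifferentiableAt ℝ (Function.uncurry F) p :=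
    hF1.mono fun _ h => h.differentiableAt (by norm_num)
  set a₀ : c.active θ ⊕ Fin m₂ → ℝ := Sum.elim lam nu with ha₀
  set Q : P × PrimalDual (c.active θ) m₂ d → ℝ := fun q => lagrangian c F (c.active θ) q.1 q.2
  set G := c.constraintFn (c.active θ) with hG
  obtain ⟨C₁, hC₁⟩ := hlip.exists_norm_sub_le h.mem_solutionSet
  have := mem_closure_iff_nhdsWithin_neBot.1 (subset_closure hw)
  obtain ⟨y, hy⟩ := hC₁.choice
  obtain ⟨C₂, hC₂⟩ := h.hasFDerivAt_fderiv.isBigO_sub.bound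
  obtain ⟨K, hK⟩ := eventually_norm_le_norm_sum_smul
    (v := fun k => fderiv ℝ (G k)) (x := θ)
    (fun k => ((c.contDiff_constraintFn _ k).continuous_fderiv (by norm_num)).continuousAt)
    h.licq.linearIndependent_fderiv
  have hw1 : Tendsto (fun w' : P => w') (𝓝[W] w) (𝓝 w) := tendsto_id.mono_left nhdsWithin_le_nhds
  have hlin0 : ∀ C : ℝ, Tendsto (fun w' => C * ‖w' - w‖) (𝓝[W] w) (𝓝 0) := fun C => by
    have : Tendsto (fun w' => C * ‖w' - w‖) (𝓝 w) (𝓝 (C * ‖w - w‖)) :=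
      Continuous.tendsto (by fun_prop) w
    simpa using this.mono_left nhdsWithin_le_nhds
  have hyt : Tendsto y (𝓝[W] w) (𝓝 θ) := by
    rw [tendsto_iff_norm_sub_tendsto_zero]
    exact squeeze_zero' (Eventually.of_forall fun _ => norm_nonneg _)
      (hy.mono fun _ h => h.2) (hlin0 C₁)
  -- The multipliers are kept at their base values here; the gradient of the Lagrangian at these
  -- points measures how far the true multipliers have moved.
  have hq : Tendsto (fun w' => (w', primalDual lam nu (y w'))) (𝓝[W] w)
      (𝓝 (w, primalDual lam nu θ)) := by
    refine hw1.prodMk_nhds ?_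
    simp only [primalDual_eq]
    exact (((primalIncl _ _ _).continuous.tendsto θ).comp hyt).const_add _
  have hinact : ∀ᶠ w' in 𝓝[W] w, ∀ i, i ∉ c.active θ → c.ineq i (y w') ≠ 0 := by
    refine eventually_all.2 fun i => ?_
    by_cases hi : i ∈ c.active θ
    · exact Eventually.of_forall fun _ h => absurd hi h
    · have h0 : c.ineq i θ ≠ 0 := fun h0 => hi (Finset.mem_filter.2 ⟨Finset.mem_univ _, h0⟩)
      exact (((c.contDiff_ineq i).continuous.tendsto θ).comp hyt).eventually_ne h0 |>.mono
        fun _ h _ => h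
  set J : EuclideanSpace ℝ (Fin d) →L[ℝ] P × PrimalDual (c.active θ) m₂ d :=
    (ContinuousLinearMap.inr ℝ P _).comp (primalIncl _ _ _) with hJ
  -- A Lipschitz constant for the multipliers: `K` inverts the constraint gradients, `C₂` bounds the
  -- change of the Lagrangian's gradient and `C₁` that of the solution.
  set C₃ : ℝ := |K| * (|C₂| * (1 + ‖primalIncl (c.active θ) m₂ d‖ * C₁) * ‖J‖) with hC₃
  have hpos : ∀ᶠ w' in 𝓝[W] w, ∀ i, C₃ * ‖w' - w‖ < lam i :=
    eventually_all.2 fun i => (hlin0 C₃).eventually (gt_mem_nhds (h.lam_pos i))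
  refine ⟨‖dualIncl (c.active θ) m₂ d‖ * C₃ + ‖primalIncl (c.active θ) m₂ d‖ * C₁, ?_⟩
  filter_upwards [hy, hq.eventually hC₂, hyt.eventually hK, hinact, hpos,
    (hw1.prodMk_nhds hyt).eventually hF1] with w' hy' hDQ hLI hin hpos' hF'
  have hFd : DifferentiableAt ℝ (Function.uncurry F) (w', y w') :=
    hF'.differentiableAt (by norm_num)
  have hli : LinearIndependent ℝ fun k => fderiv ℝ (G k) (y w') := by
    refine Fintype.linearIndependent_iff.2 fun a ha k => ?_
    have h1 := hLI a
    rw [ha, norm_zero, mul_zero] at h1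
    exact congrFun (norm_le_zero_iff.1 h1) k
  -- Near `y w'`, points at which the constraints active there vanish are feasible: the remaining
  -- inequalities are strict at `y w'` and stay strict nearby.
  have hmin : IsLocalMinOn (F w') {x | ∀ k, G k (y w') = 0 → G k x = 0} (y w') := by
    have hneg : ∀ᶠ x in 𝓝 (y w'), ∀ i, c.ineq i (y w') ≠ 0 → c.ineq i x < 0 := by
      refine eventually_all.2 fun i => ?_
      by_cases hi : c.ineq i (y w') = 0
      · exact Eventually.of_forall fun _ h => absurd hi h
      · exact ((c.contDiff_ineq i).continuous.continuousAt.eventually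
          (gt_mem_nhds ((hy'.1.1.1 i).lt_of_ne hi))).mono fun _ h _ => h
    filter_upwards [mem_nhdsWithin_of_mem_nhds hneg, self_mem_nhdsWithin] with x hx hxG
    refine hy'.1.2 x ⟨fun i => ?_, fun j => hxG (Sum.inr j) (hy'.1.1.2 j)⟩
    by_cases hi : c.ineq i (y w') = 0
    · have hia : i ∈ c.active θ := by
        by_contra hia
        exact hin i hia hi
      exact (hxG (Sum.inl ⟨i, hia⟩) hi).le
    · exact (hx i hi).le
  have hFs : HasStrictFDerivAt (F w') (fderiv ℝ (F w') (y w')) (y w') := by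
    have h1 : ContDiffAt ℝ 1 (F w') (y w') :=
      hF'.comp (y w') (f := fun y => (w', y)) (by fun_prop)
    exact h1.hasStrictFDerivAt (by norm_num)
  obtain ⟨a, ha, hsupp⟩ := exists_multipliers_supported hmin
    (fun k => c.hasStrictFDerivAt_constraintFn _ k (y w')) hFs hli
  -- the multipliers at `y w'` are close to those at `θ`
  have hdiff : ∑ k, (a - a₀) k • fderiv ℝ (G k) (y w') =
      - (fderiv ℝ Q (w', primalDual lam nu (y w'))
        - fderiv ℝ Q (w, primalDual lam nu θ)).comp J := by
    ext v
    have e1 := congrArg (fun T => T v) ha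
    have e2 := h.fderiv_stationary v
    have e3 : fderiv ℝ Q (w', primalDual lam nu (y w')) (J v) =
        fderiv ℝ (F w') (y w') v + ∑ k, a₀ k * fderiv ℝ (G k) (y w') v := by
      rw [fderiv_uncurry_right hFd]
      refine (fderiv_lagrangian_apply hFd _ _).trans ?_
      simp [primalDual_eq]
      rfl
    have e4 : fderiv ℝ Q (w, primalDual lam nu θ) (J v) =
        fderiv ℝ (F w) θ v + ∑ k, a₀ k * fderiv ℝ (G k) θ v := by
      rw [fderiv_uncurry_right hF.self_of_nhds]
      refine (fderiv_lagrangian_apply hF.self_of_nhds _ _).trans ?_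
      simp [primalDual_eq]
      rfl
    rw [e2] at e4
    simp only [add_apply, sum_apply, smul_apply, smul_eq_mul, zero_apply, neg_apply, sub_apply,
      ContinuousLinearMap.comp_apply, Pi.sub_apply, sub_mul, Finset.sum_sub_distrib] at e1 ⊢
    rw [e3, e4]
    linarith
  have hyb : ‖primalIncl (c.active θ) m₂ d (y w' - θ)‖ ≤
      ‖primalIncl (c.active θ) m₂ d‖ * C₁ * ‖w' - w‖ := by
    refine ((primalIncl _ _ _).le_opNorm _).trans ?_
    rw [mul_assoc]
    exact mul_le_mul_of_nonneg_left hy'.2 (norm_nonneg _)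
  have hqb : ‖(w', primalDual lam nu (y w')) - (w, primalDual lam nu θ)‖ ≤
      (1 + ‖primalIncl (c.active θ) m₂ d‖ * C₁) * ‖w' - w‖ := by
    have e : (w', primalDual lam nu (y w')) - (w, primalDual lam nu θ) =
        (w' - w, primalIncl (c.active θ) m₂ d (y w' - θ)) := by
      simp [primalDual_eq]
    rw [e, Prod.norm_def]
    refine max_le ?_ ?_ <;> simp only <;>
      nlinarith [norm_nonneg (w' - w), (norm_nonneg _).trans hyb]
  have hab : ‖a - a₀‖ ≤ C₃ * ‖w' - w‖ := by
    refine (hLI (a - a₀)).trans ?_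
    rw [hdiff, norm_neg]
    have h1 : ‖(fderiv ℝ Q (w', primalDual lam nu (y w'))
        - fderiv ℝ Q (w, primalDual lam nu θ)).comp J‖ ≤
        (|C₂| * ((1 + ‖primalIncl (c.active θ) m₂ d‖ * C₁) * ‖w' - w‖)) * ‖J‖ := by
      refine (ContinuousLinearMap.opNorm_comp_le _ _).trans ?_
      refine mul_le_mul_of_nonneg_right (hDQ.trans ?_) (norm_nonneg _)
      exact mul_le_mul (le_abs_self _) hqb (norm_nonneg _) (abs_nonneg _)
    calc _ ≤ |K| * ((|C₂| * ((1 + ‖primalIncl (c.active θ) m₂ d‖ * C₁) * ‖w' - w‖)) * ‖J‖) :=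
          mul_le_mul (le_abs_self _) h1 (norm_nonneg _) (abs_nonneg _)
      _ = _ := by rw [hC₃]; ring
  -- hence all constraints in `active θ` stay active
  have hact : ∀ k, G k (y w') = 0 := by
    rintro (i | j)
    · by_contra hne
      -- An inactive constraint has `a i = 0`, so the multiplier would have moved by the whole of
      -- `lam i`, against `hpos'`.
      have h1 := (norm_le_pi_norm (a - a₀) (Sum.inl i)).trans hab
      rw [Pi.sub_apply, hsupp _ hne, zero_sub, norm_neg] at h1
      exact absurd ((le_abs_self _).trans h1) (not_le.2 (hpos' i))
    · exact hy'.1.1.2 j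
  have hpp : primalPart (dualIncl (c.active θ) m₂ d a + primalIncl (c.active θ) m₂ d (y w')) =
      y w' := by simp
  refine ⟨dualIncl _ _ _ a + primalIncl _ _ _ (y w'), ?_, by rw [hpp]; exact hy'.1, by rw [hpp]; exact hFd, fun ζ => ?_⟩
  · have e : dualIncl (c.active θ) m₂ d a + primalIncl _ _ _ (y w') - primalDual lam nu θ =
        dualIncl _ _ _ (a - a₀) + primalIncl _ _ _ (y w' - θ) := by
      rw [primalDual_eq, map_sub, map_sub]; abel
    rw [e, add_mul]
    refine (norm_add_le _ _).trans (add_le_add ?_ hyb)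
    refine ((dualIncl _ _ _).le_opNorm _).trans ?_
    rw [mul_assoc]
    exact mul_le_mul_of_nonneg_left hab (norm_nonneg _)
  · have e1 := congrArg (fun T => T (primalPart ζ)) ha
    simp only [add_apply, sum_apply, smul_apply, smul_eq_mul, zero_apply] at e1
    rw [fderiv_uncurry_right hFd] at e1
    refine (fderiv_lagrangian_apply (by rw [hpp]; exact hFd) _ _).trans ?_
    rw [hpp]
    simpa [← hG, hact] using e1

end IsRegularSolution

end

/-! ### The second derivative of the value function as a bilinear form. -/

section

theorem apply_eq_sum_single {ι : Type*} [Fintype ι] [DecidableEq ι]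
    (f : EuclideanSpace ℝ ι →L[ℝ] ℝ) (z : EuclideanSpace ℝ ι) :
    f z = ∑ i, z i * f (EuclideanSpace.single i 1) := by
  conv_lhs => rw [← (EuclideanSpace.basisFun ι ℝ).sum_repr z]
  simp

theorem inner_eq_sum {ι : Type*} [Fintype ι] (x y : EuclideanSpace ℝ ι) :
    inner ℝ x y = ∑ i, x i * y i := by
  rw [PiLp.inner_apply]
  exact Finset.sum_congr rfl fun i _ => by simp [mul_comm]

theorem toEuclideanCLM_apply {ι : Type*} [Fintype ι] [DecidableEq ι] (M : Matrix ι ι ℝ)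
    (z : EuclideanSpace ℝ ι) (i : ι) :
    Matrix.toEuclideanCLM (𝕜 := ℝ) M z i = ∑ j, M i j * z j := by
  rw [Matrix.ofLp_toEuclideanCLM]
  rfl

variable {d m₁ m₂ : ℕ} {P : Type*} [NormedAddCommGroup P] [NormedSpace ℝ P]

section Forms

variable (c : ConstraintSystem d m₁ m₂) (F : P → EuclideanSpace ℝ (Fin d) → ℝ) (w : P)
  (θ : EuclideanSpace ℝ (Fin d)) (lam : c.active θ → ℝ) (nu : Fin m₂ → ℝ)

/-- The mixed second derivative of the Lagrangian as an operator from the parameters to the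
primal-dual variables. -/
noncomputable def mixedOperator : P →L[ℝ] PrimalDual (c.active θ) m₂ d :=
  ((EuclideanSpace.equiv ((c.active θ ⊕ Fin m₂) ⊕ Fin d) ℝ).symm : _ →L[ℝ] _).comp
    (ContinuousLinearMap.pi fun i =>
      ((lagrangianSecondDeriv c F w θ lam nu).flip (0, EuclideanSpace.single i 1)).comp
        (.inl ℝ _ _))

theorem mixedOperator_apply (u : P) (i) :
    mixedOperator c F w θ lam nu u i =
      lagrangianSecondDeriv c F w θ lam nu (u, 0) (0, EuclideanSpace.single i 1) := rfl

theorem inner_mixedOperator (u : P) (z) :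
    inner ℝ (mixedOperator c F w θ lam nu u) z =
      lagrangianSecondDeriv c F w θ lam nu (u, 0) (0, z) := by
  rw [inner_eq_sum]
  have := apply_eq_sum_single
    ((lagrangianSecondDeriv c F w θ lam nu (u, 0)).comp (.inr ℝ _ _)) z
  simp only [ContinuousLinearMap.comp_apply, ContinuousLinearMap.inr_apply] at this
  rw [this]
  exact Finset.sum_congr rfl fun i _ => by rw [mixedOperator_apply, mul_comm]

/-- The second derivative of the value function as a bilinear form. -/
noncomputable def valueForm : P →L[ℝ] P →L[ℝ] ℝ :=
  (lagrangianSecondDeriv c F w θ lam nu).bilinearComp (.inl ℝ _ _) (.inl ℝ _ _) -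
    ∑ i, ((EuclideanSpace.proj i).comp ((Matrix.toEuclideanCLM (𝕜 := ℝ)
        (pinv (lagrangianHessian c F w θ lam nu))).comp (mixedOperator c F w θ lam nu))).smulRight
      ((EuclideanSpace.proj i : PrimalDual (c.active θ) m₂ d →L[ℝ] ℝ).comp
        (mixedOperator c F w θ lam nu))

theorem valueForm_apply (u v : P) :
    valueForm c F w θ lam nu u v = lagrangianSecondDeriv c F w θ lam nu (u, 0) (v, 0) -
      ∑ i, ∑ j, mixedOperator c F w θ lam nu v i *
        pinv (lagrangianHessian c F w θ lam nu) i j * mixedOperator c F w θ lam nu u j := by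
  rw [valueForm, sub_apply, sub_apply, sum_apply, sum_apply]
  refine congrArg₂ _ rfl (Finset.sum_congr rfl fun i _ => ?_)
  simp only [ContinuousLinearMap.smulRight_apply, ContinuousLinearMap.comp_apply, smul_apply,
    smul_eq_mul, PiLp.proj_apply]
  rw [toEuclideanCLM_apply, Finset.sum_mul]
  exact Finset.sum_congr rfl fun j _ => by ring

theorem valueForm_apply_inner (u v : P) :
    valueForm c F w θ lam nu u v = lagrangianSecondDeriv c F w θ lam nu (u, 0) (v, 0) -
      inner ℝ (mixedOperator c F w θ lam nu v) (Matrix.toEuclideanCLM (𝕜 := ℝ)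
        (pinv (lagrangianHessian c F w θ lam nu)) (mixedOperator c F w θ lam nu u)) := by
  rw [valueForm_apply, inner_eq_sum]
  simp only [toEuclideanCLM_apply, Finset.mul_sum, mul_assoc]

end Forms

variable {c : ConstraintSystem d m₁ m₂} {F : P → EuclideanSpace ℝ (Fin d) → ℝ} {w : P} {W : Set P}
  {θ : EuclideanSpace ℝ (Fin d)} {lam : c.active θ → ℝ} {nu : Fin m₂ → ℝ}

theorem SmoothNear.hasFDerivWithinAt_valueFn {Y : Set (EuclideanSpace ℝ (Fin d))}
    (hF : SmoothNear F W Y) (hw : w ∈ W) (hlip : LocLipschitzAt (solutionSet F Y) W w)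
    {y : EuclideanSpace ℝ (Fin d)} (hy : y ∈ solutionSet F Y w) :
    HasFDerivWithinAt (valueFn F Y) (fderiv ℝ (fun w' => F w' y) w) W w := by
  have h := (hF.eventually_contDiffAt hw hy.1).self_of_nhds
  rw [fderiv_uncurry_left (h.differentiableAt (by norm_num))]
  exact BilevelPenalty.hasFDerivWithinAt_valueFn hw hlip hy (h.hasStrictFDerivAt (by norm_num))

/-- The derivative of the value function is differentiable at `w`. -/
theorem IsRegularSolution.hasFDerivWithinAt_fderivWithin_valueFn
    (h : IsRegularSolution c F w θ lam nu) (hW : UniqueDiffOn ℝ W)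
    (hF : SmoothNear F W c.feasible) (hw : w ∈ W)
    (hlip : ∀ᶠ w' in 𝓝[W] w, LocLipschitzAt (solutionSet F c.feasible) W w') :
    HasFDerivWithinAt (fderivWithin ℝ (valueFn F c.feasible) W) (valueForm c F w θ lam nu) W w := by
  have hF1 := hF.eventually_contDiffAt hw h.mem_solutionSet.1
  have hFd : ∀ᶠ p in 𝓝 (w, θ), DifferentiableAt ℝ (Function.uncurry F) p :=
    hF1.mono fun _ h => h.differentiableAt (by norm_num)
  have hsymm := h.secondDeriv_symm hFd
  have hHess := h.lagrangianHessian_apply hFd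
  obtain ⟨C, hC⟩ := h.exists_critical_near hw hF1 (hlip.self_of_nhdsWithin hw)
  refine hasFDerivWithinAt_of_critical (C := C) h.hasFDerivAt_fderiv hsymm
    (inner_mixedOperator c F w θ lam nu)
    (M := Matrix.toEuclideanCLM (𝕜 := ℝ) (lagrangianHessian c F w θ lam nu))
    (N := Matrix.toEuclideanCLM (𝕜 := ℝ) (pinv (lagrangianHessian c F w θ lam nu)))
    (fun z z' => ?_) (fun z => ?_) (hW w hw) hw ?_ (valueForm_apply_inner c F w θ lam nu)
  · rw [inner_eq_sum]
    have e1 := apply_eq_sum_single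
      ((lagrangianSecondDeriv c F w θ lam nu (0, z)).comp (.inr ℝ _ _)) z'
    simp only [ContinuousLinearMap.comp_apply, ContinuousLinearMap.inr_apply] at e1
    rw [e1]
    refine Finset.sum_congr rfl fun i _ => ?_
    rw [mul_comm, toEuclideanCLM_apply, hsymm]
    have e2 := apply_eq_sum_single
      ((lagrangianSecondDeriv c F w θ lam nu (0, EuclideanSpace.single i 1)).comp (.inr ℝ _ _)) z
    simp only [ContinuousLinearMap.comp_apply, ContinuousLinearMap.inr_apply] at e2
    rw [e2]
    congr 1
    exact Finset.sum_congr rfl fun j _ => by rw [hHess, mul_comm]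
  · have hherm : (lagrangianHessian c F w θ lam nu).IsHermitian := by
      ext i j
      rw [Matrix.conjTranspose_apply, star_trivial, hHess, hHess, hsymm]
    rw [← mul_apply_eq_comp, ← mul_apply_eq_comp, ← map_mul, ← map_mul,
      mul_pinv_mul hherm]
  -- The envelope formula is applied at the solution contained in `z`. As the constraint terms do
  -- not involve `w`, it gives the `w`-derivative of the Lagrangian at `z`.
  · filter_upwards [hC, hlip, self_mem_nhdsWithin] with w' ⟨z, hz, hzS, hzd, hcrit⟩ hlip' hw'
    refine ⟨z, hz, hcrit, fun u => ?_⟩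
    rw [(hF.hasFDerivWithinAt_valueFn hw' hlip' hzS).fderivWithin (hW w' hw'),
      fderiv_uncurry_left hzd, fderiv_lagrangian_apply hzd]
    simp

end

/-! ### Matrix formulas in coordinates. -/

section

theorem transpose_pinv {ι : Type*} [Fintype ι] [DecidableEq ι] (M : Matrix ι ι ℝ) :
    (pinv M).transpose = pinv M := by
  by_cases h : M.IsHermitian
  · have hM : M.transpose = M := by
      rw [← Matrix.conjTranspose_eq_transpose_of_trivial]; exact h
    rw [pinv, dif_pos h]
    simp only [Matrix.transpose_mul, Matrix.transpose_transpose, Matrix.transpose_nonsing_inv, hM,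
      Matrix.mul_assoc]
  · rw [pinv, dif_neg h, Matrix.transpose_zero]

theorem toDual_symm_apply {ι : Type*} [Fintype ι] [DecidableEq ι]
    (D : EuclideanSpace ℝ ι →L[ℝ] ℝ) (i : ι) :
    (InnerProductSpace.toDual ℝ (EuclideanSpace ℝ ι)).symm D i =
      D (EuclideanSpace.single i 1) := by
  have := InnerProductSpace.toDual_symm_apply (𝕜 := ℝ) (x := EuclideanSpace.single i (1 : ℝ)) (y := D)
  rw [← this, EuclideanSpace.inner_single_right]
  simp

theorem gradient_coord {ι : Type*} [Fintype ι] [DecidableEq ι]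
    (φ : EuclideanSpace ℝ ι → ℝ) (x : EuclideanSpace ℝ ι) (i : ι) :
    gradient φ x i = fderiv ℝ φ x (EuclideanSpace.single i 1) :=
  toDual_symm_apply _ i

theorem gradientWithin_coord {ι : Type*} [Fintype ι] [DecidableEq ι]
    (φ : EuclideanSpace ℝ ι → ℝ) (X : Set (EuclideanSpace ℝ ι)) (x : EuclideanSpace ℝ ι) (i : ι) :
    gradientWithin φ X x i = fderivWithin ℝ φ X x (EuclideanSpace.single i 1) :=
  toDual_symm_apply _ i

variable {d m₁ m₂ : ℕ}

section General

variable {P : Type*} [NormedAddCommGroup P] [NormedSpace ℝ P]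
  {c : ConstraintSystem d m₁ m₂} {F : P → EuclideanSpace ℝ (Fin d) → ℝ} {w : P}
  {θ : EuclideanSpace ℝ (Fin d)} {lam : c.active θ → ℝ} {nu : Fin m₂ → ℝ}

namespace IsRegularSolution

theorem mixedOperator_inl (h : IsRegularSolution c F w θ lam nu)
    (hF : ∀ᶠ p in 𝓝 (w, θ), DifferentiableAt ℝ (Function.uncurry F) p) (u : P)
    (k : c.active θ ⊕ Fin m₂) : mixedOperator c F w θ lam nu u (Sum.inl k) = 0 :=
  h.secondDeriv_left_dual hF u k

theorem hasFDerivAt_mixedOperator_inr (h : IsRegularSolution c F w θ lam nu)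
    (hF : ∀ᶠ p in 𝓝 (w, θ), DifferentiableAt ℝ (Function.uncurry F) p) (j : Fin d) :
    HasFDerivAt (fun w' => fderiv ℝ (F w') θ (EuclideanSpace.single j 1))
      ((EuclideanSpace.proj (Sum.inr j)).comp (mixedOperator c F w θ lam nu)) w := by
  refine (h.hasFDerivAt_fderiv_right hF (EuclideanSpace.single j 1)).congr_fderiv ?_
  ext u
  simp [mixedOperator_apply, single_inr]

theorem valueForm_symm (h : IsRegularSolution c F w θ lam nu)
    (hF : ∀ᶠ p in 𝓝 (w, θ), DifferentiableAt ℝ (Function.uncurry F) p) (u v : P) :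
    valueForm c F w θ lam nu u v = valueForm c F w θ lam nu v u := by
  rw [valueForm_apply, valueForm_apply, h.secondDeriv_symm hF, Finset.sum_comm]
  congr 1
  refine Finset.sum_congr rfl fun i _ => Finset.sum_congr rfl fun j _ => ?_
  rw [← transpose_pinv, Matrix.transpose_apply, transpose_pinv]
  ring

end IsRegularSolution

end General

section Hessian

variable {p : ℕ} {c : ConstraintSystem d m₁ m₂}
  {F : EuclideanSpace ℝ (Fin p) → EuclideanSpace ℝ (Fin d) → ℝ} {w : EuclideanSpace ℝ (Fin p)}
  {θ : EuclideanSpace ℝ (Fin d)} {lam : c.active θ → ℝ} {nu : Fin m₂ → ℝ}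

/-- The direction of differentiation is the first argument of the form, hence the column index `j`
of the matrix acting on it; the row `i` selects a coordinate of the gradient. -/
theorem IsRegularSolution.valueHessian_apply (h : IsRegularSolution c F w θ lam nu)
    (hF : ∀ᶠ p in 𝓝 (w, θ), DifferentiableAt ℝ (Function.uncurry F) p) (i j : Fin p) :
    valueHessian c F w θ lam nu i j =
      valueForm c F w θ lam nu (EuclideanSpace.single j 1) (EuclideanSpace.single i 1) := by
  have hcols : ∀ i k, Matrix.fromCols (0 : Matrix (Fin p) (c.active θ ⊕ Fin m₂) ℝ)
      (crossHessian F w θ) i k =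
        mixedOperator c F w θ lam nu (EuclideanSpace.single i 1) k := by
    rintro i (k | k)
    · rw [h.mixedOperator_inl hF]; rfl
    · change fderiv ℝ _ w _ = _
      rw [(h.hasFDerivAt_mixedOperator_inr hF k).fderiv]
      simp
  have hrows : ∀ k j, Matrix.fromRows (0 : Matrix (c.active θ ⊕ Fin m₂) (Fin p) ℝ)
      (crossHessian (fun θ' w' => F w' θ') θ w) k j =
        mixedOperator c F w θ lam nu (EuclideanSpace.single j 1) k := by
    rintro (k | k) j
    · rw [h.mixedOperator_inl hF]; rfl
    · change fderiv ℝ _ θ _ = _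
      rw [(h.hasFDerivAt_fderiv_left_right hF _).fderiv, mixedOperator_apply, h.secondDeriv_symm hF,
        single_inr]
      simp
  have hhess : hessianMatrix (fun w' => F w' θ) w i j = lagrangianSecondDeriv c F w θ lam nu
      (EuclideanSpace.single j 1, 0) (EuclideanSpace.single i 1, 0) := by
    change fderiv ℝ _ w _ = _
    rw [(h.hasFDerivAt_fderiv_left hF _).fderiv, h.secondDeriv_symm hF]
    simp
  rw [valueHessian, Matrix.sub_apply, hhess, valueForm_apply, Finset.sum_comm]
  simp only [Matrix.mul_apply, hcols, hrows, Finset.sum_mul]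

theorem IsRegularSolution.hasFDerivWithinAt_gradientWithin_valueFn
    {W : Set (EuclideanSpace ℝ (Fin p))}
    (h : IsRegularSolution c F w θ lam nu) (hW : UniqueDiffOn ℝ W)
    (hF : SmoothNear F W c.feasible) (hw : w ∈ W)
    (hlip : ∀ᶠ w' in 𝓝[W] w, LocLipschitzAt (solutionSet F c.feasible) W w') :
    HasFDerivWithinAt (gradientWithin (valueFn F c.feasible) W)
      (Matrix.toEuclideanCLM (𝕜 := ℝ) (valueHessian c F w θ lam nu)) W w := by
  have hFd : ∀ᶠ p in 𝓝 (w, θ), DifferentiableAt ℝ (Function.uncurry F) p :=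
    (hF.eventually_contDiffAt hw h.mem_solutionSet.1).mono fun _ h =>
      h.differentiableAt (by norm_num)
  refine hasFDerivWithinAt_euclidean.2 fun i => ?_
  simp only [gradientWithin_coord]
  have h1 := (ContinuousLinearMap.apply ℝ ℝ (EuclideanSpace.single i (1 : ℝ) :
    EuclideanSpace ℝ (Fin p))).hasFDerivAt.comp_hasFDerivWithinAt w
      (h.hasFDerivWithinAt_fderivWithin_valueFn hW hF hw hlip)
  refine h1.congr_fderiv ?_
  ext u
  have e := apply_eq_sum_single ((valueForm c F w θ lam nu).flip (EuclideanSpace.single i 1)) u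
  simp only [ContinuousLinearMap.flip_apply] at e
  simp only [ContinuousLinearMap.comp_apply, ContinuousLinearMap.apply_apply, PiLp.proj_apply,
    toEuclideanCLM_apply, e, h.valueHessian_apply hFd]
  exact Finset.sum_congr rfl fun j _ => mul_comm _ _

end Hessian

/-! ### The bilevel objective with parameter `(x, σ)`. -/

section Bilevel

variable {n : ℕ} {c : ConstraintSystem d m₁ m₂}
  {f g : EuclideanSpace ℝ (Fin n) → EuclideanSpace ℝ (Fin d) → ℝ}
  {X : Set (EuclideanSpace ℝ (Fin n))} {Y : Set (EuclideanSpace ℝ (Fin d))} {σ₀ : ℝ}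
  {x : EuclideanSpace ℝ (Fin n)} {σ : ℝ} {y : EuclideanSpace ℝ (Fin d)}

theorem SmoothNear.perturbed (hf : SmoothNear f X Y) (hg : SmoothNear g X Y) (T : Set ℝ) :
    SmoothNear (perturbed f g) (X ×ˢ T) Y := by
  obtain ⟨U, hU, hUs, hUc⟩ := hf
  obtain ⟨V, hV, hVs, hVc⟩ := hg
  have hπ : ContDiff ℝ 1 (fun p : (EuclideanSpace ℝ (Fin n) × ℝ) × EuclideanSpace ℝ (Fin d) =>
    (p.1.1, p.2)) := by fun_prop
  refine ⟨(fun p => (p.1.1, p.2)) ⁻¹' (U ∩ V), (hU.inter hV).preimage hπ.continuous, ?_, ?_⟩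
  · rintro ⟨⟨a, s⟩, b⟩ ⟨⟨ha, -⟩, hb⟩
    exact ⟨hUs ⟨ha, hb⟩, hVs ⟨ha, hb⟩⟩
  · have h1 := hUc.comp hπ.contDiffOn (s := (fun p => (p.1.1, p.2)) ⁻¹' (U ∩ V)) fun p hp => hp.1
    have h2 := hVc.comp hπ.contDiffOn (s := (fun p => (p.1.1, p.2)) ⁻¹' (U ∩ V)) fun p hp => hp.2
    have h3 : ContDiff ℝ 1 (fun p : (EuclideanSpace ℝ (Fin n) × ℝ) × EuclideanSpace ℝ (Fin d) =>
      p.1.2) := by fun_prop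
    exact (h3.contDiffOn.mul h1).add h2

theorem perturbed_zero (x : EuclideanSpace ℝ (Fin n)) : perturbed f g (x, 0) = g x := by
  funext y; simp [perturbed]

theorem fderiv_perturbed_right (hf : DifferentiableAt ℝ (f x) y) (hg : DifferentiableAt ℝ (g x) y)
    (s : ℝ) (v : EuclideanSpace ℝ (Fin d)) :
    fderiv ℝ (perturbed f g (x, s)) y v = s * fderiv ℝ (f x) y v + fderiv ℝ (g x) y v := by
  have h : HasFDerivAt (perturbed f g (x, s)) (s • fderiv ℝ (f x) y + fderiv ℝ (g x) y) y :=
    (hf.hasFDerivAt.const_mul s).add hg.hasFDerivAt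
  rw [h.fderiv]
  simp

theorem fderiv_perturbed_left (hf : DifferentiableAt ℝ (fun x' => f x' y) x)
    (hg : DifferentiableAt ℝ (fun x' => g x' y) x) (s : ℝ) (v : EuclideanSpace ℝ (Fin n)) (t : ℝ) :
    fderiv ℝ (fun w => perturbed f g w y) (x, s) (v, t) =
      s * fderiv ℝ (fun x' => f x' y) x v + t * f x y + fderiv ℝ (fun x' => g x' y) x v := by
  have h1 := HasFDerivAt.comp (x, s) (f := Prod.fst) (g := fun x' => f x' y) hf.hasFDerivAt
    (hasFDerivAt_fst (𝕜 := ℝ))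
  have h2 := HasFDerivAt.comp (x, s) (f := Prod.fst) (g := fun x' => g x' y) hg.hasFDerivAt
    (hasFDerivAt_fst (𝕜 := ℝ))
  have h3 : HasFDerivAt (fun w : EuclideanSpace ℝ (Fin n) × ℝ => w.2) _ (x, s) :=
    hasFDerivAt_snd (𝕜 := ℝ)
  have h : HasFDerivAt (fun w => BilevelPenalty.perturbed f g w y) _ (x, s) := (h3.mul h1).add h2
  rw [h.fderiv]
  simp [mul_comm]

theorem SmoothNear.differentiableAt_right (hf : SmoothNear f X Y) (hx : x ∈ X) (hy : y ∈ Y) :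
    DifferentiableAt ℝ (f x) y :=
  ((hf.eventually_contDiffAt hx hy).self_of_nhds.differentiableAt (by norm_num)).comp
    (f := fun y => (x, y)) y (by fun_prop)

theorem SmoothNear.differentiableAt_left (hf : SmoothNear f X Y) (hx : x ∈ X) (hy : y ∈ Y) :
    DifferentiableAt ℝ (fun x' => f x' y) x :=
  ((hf.eventually_contDiffAt hx hy).self_of_nhds.differentiableAt (by norm_num)).comp
    (f := fun x' => (x', y)) x (by fun_prop)

/-- Since `h_σ` is affine in `σ` with slope `f`, differentiating `∇_x h_σ` and `∇_y h_σ` in `σ`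
leaves `∇_x f` and `∇_y f`; these are the entries of the form in the direction `(0, 1)`. -/
theorem IsRegularSolution.mixedDerivative_apply {lam : c.active y → ℝ} {nu : Fin m₂ → ℝ}
    (h : IsRegularSolution c (perturbed f g) (x, σ) y lam nu)
    (hf : SmoothNear f X c.feasible) (hg : SmoothNear g X c.feasible) (hx : x ∈ X)
    (i : Fin n) :
    mixedDerivative c f g x σ y lam nu i =
      valueForm c (perturbed f g) (x, σ) y lam nu (0, 1) (EuclideanSpace.single i 1, 0) := by
  have hy := h.mem_solutionSet.1
  have hF : ∀ᶠ p in 𝓝 ((x, σ), y), DifferentiableAt ℝ (Function.uncurry (perturbed f g)) p :=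
    ((hf.perturbed hg univ).eventually_contDiffAt ⟨hx, mem_univ σ⟩ hy).mono fun _ h =>
      h.differentiableAt (by norm_num)
  have hpath : HasDerivAt (fun s : ℝ => (x, s)) ((0 : EuclideanSpace ℝ (Fin n)), (1 : ℝ)) σ :=
    (hasDerivAt_const σ x).prodMk (hasDerivAt_id σ)
  have hcols : ∀ i k, Matrix.fromCols (0 : Matrix (Fin n) (c.active y ⊕ Fin m₂) ℝ)
      (crossHessian (fun x' y' => perturbed f g (x', σ) y') x y) i k =
        mixedOperator c (perturbed f g) (x, σ) y lam nu (EuclideanSpace.single i 1, 0) k := by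
    rintro i (k | k)
    · rw [h.mixedOperator_inl hF]; rfl
    · change fderiv ℝ _ x _ = _
      have h1 := HasFDerivAt.comp x (f := fun x' => (x', σ))
        (h.hasFDerivAt_mixedOperator_inr hF k) (hasFDerivAt_prodMk_left x σ)
      refine (congrArg (fun T => T (EuclideanSpace.single i 1)) h1.fderiv).trans ?_
      simp
  have hgrad : ∀ k, (Sum.elim 0 (fun k => gradient (f x) y k) : _ → ℝ) k =
      mixedOperator c (perturbed f g) (x, σ) y lam nu (0, 1) k := by
    rintro (k | k)
    · rw [h.mixedOperator_inl hF]; rfl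
    · have h1 := HasFDerivAt.comp_hasDerivAt σ (f := fun s => (x, s))
        (h.hasFDerivAt_mixedOperator_inr hF k) hpath
      have h2 : HasDerivAt (fun s => s * fderiv ℝ (f x) y (EuclideanSpace.single k 1) +
          fderiv ℝ (g x) y (EuclideanSpace.single k 1)) _ σ :=
        ((hasDerivAt_id σ).mul_const _).add_const _
      have h3 := h1.unique (h2.congr_of_eventuallyEq (.of_forall fun s =>
        fderiv_perturbed_right (hf.differentiableAt_right hx hy) (hg.differentiableAt_right hx hy)
          s _))
      simpa [gradient_coord] using h3.symm
  have hfirst : lagrangianSecondDeriv c (perturbed f g) (x, σ) y lam nu ((0, 1), 0)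
      ((EuclideanSpace.single i 1, 0), 0) = gradient (fun x' => f x' y) x i := by
    have h1 := HasFDerivAt.comp_hasDerivAt σ (f := fun s => (x, s))
      (h.hasFDerivAt_fderiv_left hF (EuclideanSpace.single i 1, 0)) hpath
    have h2 : HasDerivAt (fun s => s * fderiv ℝ (fun x' => f x' y) x (EuclideanSpace.single i 1) +
        0 * f x y + fderiv ℝ (fun x' => g x' y) x (EuclideanSpace.single i 1)) _ σ :=
      (((hasDerivAt_id σ).mul_const _).add_const _).add_const _
    have h3 := h1.unique (h2.congr_of_eventuallyEq (.of_forall fun s =>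
      fderiv_perturbed_left (hf.differentiableAt_left hx hy) (hg.differentiableAt_left hx hy)
        s _ _))
    simpa [gradient_coord] using h3
  rw [valueForm_apply, hfirst, mixedDerivative, PiLp.sub_apply, Finset.sum_comm]
  simp only [Matrix.mulVec, dotProduct, hgrad, Matrix.mul_apply, hcols, Finset.sum_mul]

end Bilevel

end

/-! ### Partial derivatives of the lower-level value and the limit `σ → 0⁺`. -/

section Partial

variable {n d : ℕ} {f g : EuclideanSpace ℝ (Fin n) → EuclideanSpace ℝ (Fin d) → ℝ}
  {X : Set (EuclideanSpace ℝ (Fin n))} {Y : Set (EuclideanSpace ℝ (Fin d))} {T : Set ℝ}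
  {x : EuclideanSpace ℝ (Fin n)} {s : ℝ} {D : EuclideanSpace ℝ (Fin n) × ℝ →L[ℝ] ℝ}

theorem hasFDerivWithinAt_lowerValue_left
    (h : HasFDerivWithinAt (valueFn (perturbed f g) Y) D (X ×ˢ T) (x, s)) (hs : s ∈ T) :
    HasFDerivWithinAt (fun x' => lowerValue f g Y x' s) (D.comp (.inl ℝ _ _)) X x :=
  HasFDerivWithinAt.comp x (f := fun x' => (x', s)) h
    (hasFDerivAt_prodMk_left x s).hasFDerivWithinAt fun _ hx' => ⟨hx', hs⟩

theorem hasDerivWithinAt_lowerValue_right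
    (h : HasFDerivWithinAt (valueFn (perturbed f g) Y) D (X ×ˢ T) (x, s)) (hx : x ∈ X) :
    HasDerivWithinAt (fun s' => lowerValue f g Y x s') (D (0, 1)) T s :=
  HasFDerivWithinAt.comp_hasDerivWithinAt s (f := fun s' => (x, s')) h
    ((hasDerivAt_const s x).prodMk (hasDerivAt_id s)).hasDerivWithinAt fun _ hs' => ⟨hx, hs'⟩

/-- By the envelope formula, every minimizer `y` of `g(x, ·)` gives the same right derivative `f(x,
y)`. So `f(x, ·)` is constant on the minimizers, and the infimum is taken over a single value. -/
theorem hyperObjective_eq (hf : SmoothNear f X Y) (hg : SmoothNear g X Y)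
    (hY : IsCompact Y) (hne : Y.Nonempty) (hx : x ∈ X) (h0 : (0 : ℝ) ∈ T)
    (hT : UniqueDiffWithinAt ℝ T 0)
    (hlip : LocLipschitzAt (solutionSet (perturbed f g) Y) (X ×ˢ T) (x, 0)) :
    hyperObjective f g Y x = derivWithin (fun s => lowerValue f g Y x s) T 0 := by
  have hS : solutionSet (perturbed f g) Y (x, 0) = solutionSet g Y x := by
    simp only [solutionSet, perturbed_zero]
  have hF := hf.perturbed hg T
  have hval : ∀ y ∈ solutionSet g Y x,
      f x y = derivWithin (fun s => lowerValue f g Y x s) T 0 := fun y hy => by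
    have h1 := hasDerivWithinAt_lowerValue_right
      (hF.hasFDerivWithinAt_valueFn ⟨hx, h0⟩ hlip (hS ▸ hy)) hx
    rw [h1.derivWithin hT, fderiv_perturbed_left (hf.differentiableAt_left hx hy.1)
      (hg.differentiableAt_left hx hy.1)]
    simp
  have himg : f x '' solutionSet g Y x = {derivWithin (fun s => lowerValue f g Y x s) T 0} :=
    Set.Nonempty.image_const (s := solutionSet g Y x) (hg.nonempty_solutionSet hY hne hx) _ ▸
      Set.image_congr hval
  rw [hyperObjective, himg, csInf_singleton]

end Partial

/-- The mixed second derivatives of the lower-level value function, and the hyper-objective as its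
right derivative in `σ` at `0`. -/
theorem IsRegularSolution.mixed_derivatives {n d m₁ m₂ : ℕ} {c : ConstraintSystem d m₁ m₂}
    {X : Set (EuclideanSpace ℝ (Fin n))}
    {f g : EuclideanSpace ℝ (Fin n) → EuclideanSpace ℝ (Fin d) → ℝ} {σ₀ σ : ℝ}
    {x : EuclideanSpace ℝ (Fin n)} {y : EuclideanSpace ℝ (Fin d)} {lam : c.active y → ℝ}
    {nu : Fin m₂ → ℝ} (h : IsRegularSolution c (perturbed f g) (x, σ) y lam nu)
    (hbdd : Bornology.IsBounded c.feasible) (hXconv : Convex ℝ X) (hXint : (interior X).Nonempty)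
    (hf : SmoothNear f X c.feasible) (hg : SmoothNear g X c.feasible) (hσ₀ : 0 < σ₀)
    (hx : x ∈ X) (hσ : σ ∈ Icc 0 σ₀)
    (hlip : ∀ᶠ w' in 𝓝[X ×ˢ Icc 0 σ₀] (x, σ),
      LocLipschitzAt (solutionSet (perturbed f g) c.feasible) (X ×ˢ Icc 0 σ₀) w') :
        (∀ᶠ w' in 𝓝[X ×ˢ Icc 0 σ₀] (x, σ),
          DifferentiableWithinAt ℝ (fun x' => lowerValue f g c.feasible x' w'.2) X w'.1 ∧
          DifferentiableWithinAt ℝ (fun s => lowerValue f g c.feasible w'.1 s)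
            (Icc 0 σ₀) w'.2) ∧
        HasDerivWithinAt
          (fun s => gradientWithin (fun x' => lowerValue f g c.feasible x' s) X x)
          (mixedDerivative c f g x σ y lam nu) (Icc 0 σ₀) σ ∧
        HasGradientWithinAt
          (fun x' => derivWithin (fun s => lowerValue f g c.feasible x' s) (Icc 0 σ₀) σ)
          (mixedDerivative c f g x σ y lam nu) X x ∧
        (σ = 0 →
          HasGradientWithinAt (hyperObjective f g c.feasible)
            (mixedDerivative c f g x σ y lam nu) X x ∧
          (∀ᶠ s in 𝓝[>] (0 : ℝ),
            DifferentiableWithinAt ℝ (penalized f g c.feasible s) X x) ∧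
          Tendsto (fun s => gradientWithin (penalized f g c.feasible s) X x) (𝓝[>] (0 : ℝ))
            (𝓝 (gradientWithin (hyperObjective f g c.feasible) X x))) := by
  have hXu : UniqueDiffOn ℝ X := uniqueDiffOn_convex hXconv hXint
  have hTu : UniqueDiffOn ℝ (Icc 0 σ₀) := uniqueDiffOn_Icc hσ₀
  have hWu : UniqueDiffOn ℝ (X ×ˢ Icc 0 σ₀) := hXu.prod hTu
  have hF := hf.perturbed hg (Icc 0 σ₀)
  have hw : (x, σ) ∈ X ×ˢ Icc 0 σ₀ := ⟨hx, hσ⟩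
  have hY := c.isCompact_feasible hbdd
  have hne : c.feasible.Nonempty := ⟨y, h.mem_solutionSet.1⟩
  have hFd : ∀ᶠ p in 𝓝 ((x, σ), y), DifferentiableAt ℝ (Function.uncurry (perturbed f g)) p :=
    (hF.eventually_contDiffAt hw h.mem_solutionSet.1).mono fun _ h =>
      h.differentiableAt (by norm_num)
  have hD2 := h.hasFDerivWithinAt_fderivWithin_valueFn hWu hF hw hlip
  have hD1 : ∀ᶠ w' in 𝓝[X ×ˢ Icc 0 σ₀] (x, σ),
      HasFDerivWithinAt (valueFn (perturbed f g) c.feasible)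
        (fderivWithin ℝ (valueFn (perturbed f g) c.feasible) (X ×ˢ Icc 0 σ₀) w')
        (X ×ˢ Icc 0 σ₀) w' := by
    filter_upwards [hlip, self_mem_nhdsWithin] with w' hl hw'
    obtain ⟨y', hy'⟩ := hF.nonempty_solutionSet hY hne hw'
    exact (hF.hasFDerivWithinAt_valueFn hw' hl hy').differentiableWithinAt.hasFDerivWithinAt
  have hleft : Tendsto (fun x' => (x', σ)) (𝓝[X] x) (𝓝[X ×ˢ Icc 0 σ₀] (x, σ)) :=
    ContinuousWithinAt.tendsto_nhdsWithin (by fun_prop) fun _ hx' => ⟨hx', hσ⟩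
  have hright : Tendsto (fun s => (x, s)) (𝓝[Icc 0 σ₀] σ) (𝓝[X ×ˢ Icc 0 σ₀] (x, σ)) :=
    ContinuousWithinAt.tendsto_nhdsWithin (by fun_prop) fun _ hs => ⟨hx, hs⟩
  have hμ := h.mixedDerivative_apply hf hg hx
  have hgrad : HasDerivWithinAt
      (fun s => gradientWithin (fun x' => lowerValue f g c.feasible x' s) X x)
      (mixedDerivative c f g x σ y lam nu) (Icc 0 σ₀) σ := by
    rw [hasDerivWithinAt_iff_hasFDerivWithinAt]
    refine hasFDerivWithinAt_euclidean.2 fun i => ?_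
    simp only [gradientWithin_coord]
    have h1 := HasFDerivAt.comp_hasDerivWithinAt σ
      (ContinuousLinearMap.apply ℝ ℝ ((EuclideanSpace.single i (1 : ℝ) :
        EuclideanSpace ℝ (Fin n)), (0 : ℝ))).hasFDerivAt
      (HasFDerivWithinAt.comp_hasDerivWithinAt σ (f := fun s => (x, s)) hD2
        ((hasDerivAt_const σ x).prodMk (hasDerivAt_id σ)).hasDerivWithinAt fun _ hs => ⟨hx, hs⟩)
    have heq : (fun s => fderivWithin ℝ (fun x' => lowerValue f g c.feasible x' s) X x
        (EuclideanSpace.single i 1)) =ᶠ[𝓝[Icc 0 σ₀] σ] fun s =>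
        fderivWithin ℝ (valueFn (perturbed f g) c.feasible) (X ×ˢ Icc 0 σ₀) (x, s)
          (EuclideanSpace.single i 1, 0) := by
      filter_upwards [hright.eventually hD1, self_mem_nhdsWithin] with s hs hsT
      rw [(hasFDerivWithinAt_lowerValue_left hs hsT).fderivWithin (hXu x hx)]
      simp
    have h2 := (h1.congr_of_eventuallyEq heq (heq.self_of_nhdsWithin hσ)).hasFDerivWithinAt
    refine h2.congr_fderiv ?_
    ext
    simp [hμ]
  have hpart : HasGradientWithinAt
      (fun x' => derivWithin (fun s => lowerValue f g c.feasible x' s) (Icc 0 σ₀) σ)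
      (mixedDerivative c f g x σ y lam nu) X x := by
    rw [hasGradientWithinAt_iff_hasFDerivWithinAt]
    have h1 := (ContinuousLinearMap.apply ℝ ℝ ((0 : EuclideanSpace ℝ (Fin n)),
      (1 : ℝ))).hasFDerivAt.comp_hasFDerivWithinAt x
      (HasFDerivWithinAt.comp x (f := fun x' => (x', σ)) hD2
        (hasFDerivAt_prodMk_left x σ).hasFDerivWithinAt fun _ hx' => ⟨hx', hσ⟩)
    have heq : (fun x' => derivWithin (fun s => lowerValue f g c.feasible x' s) (Icc 0 σ₀) σ)
        =ᶠ[𝓝[X] x] fun x' =>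
        fderivWithin ℝ (valueFn (perturbed f g) c.feasible) (X ×ˢ Icc 0 σ₀) (x', σ) (0, 1) := by
      filter_upwards [hleft.eventually hD1, self_mem_nhdsWithin] with x' hx' hxX
      exact (hasDerivWithinAt_lowerValue_right hx' hxX).derivWithin (hTu σ hσ)
    refine (h1.congr_of_eventuallyEq heq (heq.self_of_nhdsWithin hx)).congr_fderiv ?_
    ext v
    have e := apply_eq_sum_single (((valueForm c (perturbed f g) (x, σ) y lam nu) (0, 1)).comp
      (.inl ℝ _ _)) v
    simp only [ContinuousLinearMap.comp_apply, ContinuousLinearMap.inl_apply, ← hμ] at e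
    rw [InnerProductSpace.toDual_apply_apply, inner_eq_sum]
    simp only [ContinuousLinearMap.comp_apply, ContinuousLinearMap.inl_apply,
      ContinuousLinearMap.apply_apply]
    -- Here `x` is the outer variable, whereas `hμ` has `σ` outermost; symmetry of the form makes
    -- the two mixed derivatives equal.
    rw [h.valueForm_symm hFd, e]
    exact Finset.sum_congr rfl fun i _ => mul_comm _ _
  refine ⟨?_, hgrad, hpart, ?_⟩
  · filter_upwards [hD1, self_mem_nhdsWithin] with w' hw' hwW
    exact ⟨(hasFDerivWithinAt_lowerValue_left hw' hwW.2).differentiableWithinAt,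
      (hasDerivWithinAt_lowerValue_right hw' hwW.1).differentiableWithinAt⟩
  rintro rfl
  have hψ : HasGradientWithinAt (hyperObjective f g c.feasible)
      (mixedDerivative c f g x 0 y lam nu) X x := by
    rw [hasGradientWithinAt_iff_hasFDerivWithinAt] at hpart ⊢
    have heq : hyperObjective f g c.feasible =ᶠ[𝓝[X] x] fun x' =>
        derivWithin (fun s => lowerValue f g c.feasible x' s) (Icc 0 σ₀) 0 := by
      filter_upwards [hleft.eventually hlip, self_mem_nhdsWithin] with x' hx' hxX
      exact hyperObjective_eq hf hg hY hne hxX hσ (hTu 0 hσ) hx'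
    exact hpart.congr_of_eventuallyEq heq (heq.self_of_nhdsWithin hx)
  have hIoi : 𝓝[>] (0 : ℝ) ≤ 𝓝[Icc 0 σ₀ \ {0}] 0 := by
    rw [← nhdsWithin_Ioc_eq_nhdsGT hσ₀]
    exact nhdsWithin_mono _ fun s hs => ⟨⟨hs.1.le, hs.2⟩, hs.1.ne'⟩
  have hIoi' : 𝓝[>] (0 : ℝ) ≤ 𝓝[Icc 0 σ₀] 0 := hIoi.trans (nhdsWithin_mono _ sdiff_subset)
  have hdiff : ∀ᶠ s in 𝓝[Icc 0 σ₀] (0 : ℝ),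
      DifferentiableWithinAt ℝ (fun x' => lowerValue f g c.feasible x' s) X x := by
    filter_upwards [hright.eventually hD1, self_mem_nhdsWithin] with s hs hsT
    exact (hasFDerivWithinAt_lowerValue_left hs hsT).differentiableWithinAt
  have hdiff0 := hdiff.self_of_nhdsWithin hσ
  -- The filter includes `s = 0`, where both sides are zero by the convention for division by zero.
  have hpen : ∀ᶠ s in 𝓝[Icc 0 σ₀] (0 : ℝ), HasFDerivWithinAt (penalized f g c.feasible s)
      (s⁻¹ • (fderivWithin ℝ (fun x' => lowerValue f g c.feasible x' s) X x -
        fderivWithin ℝ (fun x' => lowerValue f g c.feasible x' 0) X x)) X x := by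
    filter_upwards [hdiff] with s hs
    have e : penalized f g c.feasible s = fun x' => s⁻¹ *
        (lowerValue f g c.feasible x' s - lowerValue f g c.feasible x' 0) := by
      funext x'
      simp only [penalized, lowerValue, valueFn, perturbed_zero, div_eq_inv_mul]
    rw [e]
    exact (hs.hasFDerivWithinAt.sub hdiff0.hasFDerivWithinAt).const_mul _
  refine ⟨hψ, (hpen.filter_mono hIoi').mono fun s hs => hs.differentiableWithinAt, ?_⟩
  have hψg : gradientWithin (hyperObjective f g c.feasible) X x =
      mixedDerivative c f g x 0 y lam nu := by
    rw [gradientWithin, (hasGradientWithinAt_iff_hasFDerivWithinAt.1 hψ).fderivWithin (hXu x hx),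
      LinearIsometryEquiv.symm_apply_apply]
  rw [hψg]
  -- The gradient of `ψ_s` is exactly the slope of `s ↦ ∇_x l(x, s)` between `0` and `s`.
  refine ((hasDerivWithinAt_iff_tendsto_slope.1 hgrad).mono_left hIoi).congr' ?_
  filter_upwards [hpen.filter_mono hIoi'] with s hs
  rw [slope_def_module, sub_zero]
  simp only [gradientWithin]
  rw [hs.fderivWithin (hXu x hx), map_smulₛₗ, map_sub]
  simp

end BilevelPenalty

theorem mainTheorem2 {d m₁ m₂ : ℕ} (c : ConstraintSystem d m₁ m₂)
    (hbdd : Bornology.IsBounded c.feasible) :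
    -- general parametric form: the Hessian of the value function
    (∀ {p : ℕ} (W : Set (EuclideanSpace ℝ (Fin p)))
        (F : EuclideanSpace ℝ (Fin p) → EuclideanSpace ℝ (Fin d) → ℝ),
      IsClosed W → Convex ℝ W → (interior W).Nonempty →
      SmoothNear F W c.feasible →
      ∀ w ∈ W,
      (∀ᶠ w' in 𝓝[W] w, LocLipschitzAt (solutionSet F c.feasible) W w') →
      ∀ (θ : EuclideanSpace ℝ (Fin d)) (lam : c.active θ → ℝ) (nu : Fin m₂ → ℝ),
      IsRegularSolution c F w θ lam nu →
        (∀ᶠ w' in 𝓝[W] w, DifferentiableWithinAt ℝ (valueFn F c.feasible) W w') ∧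
        HasFDerivWithinAt (gradientWithin (valueFn F c.feasible) W)
          (Matrix.toEuclideanCLM (𝕜 := ℝ) (valueHessian c F w θ lam nu)) W w) ∧
    -- bilevel form: the mixed second derivatives of `l(x, σ)`
    (∀ {n : ℕ} (X : Set (EuclideanSpace ℝ (Fin n)))
        (f g : EuclideanSpace ℝ (Fin n) → EuclideanSpace ℝ (Fin d) → ℝ) (σ₀ : ℝ),
      IsClosed X → Convex ℝ X → (interior X).Nonempty →
      SmoothNear f X c.feasible → SmoothNear g X c.feasible → 0 < σ₀ →
      ∀ x ∈ X, ∀ σ ∈ Icc 0 σ₀,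
      (∀ᶠ w' in 𝓝[X ×ˢ Icc 0 σ₀] (x, σ),
        LocLipschitzAt (solutionSet (perturbed f g) c.feasible) (X ×ˢ Icc 0 σ₀) w') →
      ∀ (y : EuclideanSpace ℝ (Fin d)) (lam : c.active y → ℝ) (nu : Fin m₂ → ℝ),
      IsRegularSolution c (perturbed f g) (x, σ) y lam nu →
        -- the first partial derivatives exist near `(x, σ)`
        (∀ᶠ w' in 𝓝[X ×ˢ Icc 0 σ₀] (x, σ),
          DifferentiableWithinAt ℝ (fun x' => lowerValue f g c.feasible x' w'.2) X w'.1 ∧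
          DifferentiableWithinAt ℝ (fun s => lowerValue f g c.feasible w'.1 s)
            (Icc 0 σ₀) w'.2) ∧
        -- the derivative in `σ` of the gradient in `x`
        HasDerivWithinAt
          (fun s => gradientWithin (fun x' => lowerValue f g c.feasible x' s) X x)
          (mixedDerivative c f g x σ y lam nu) (Icc 0 σ₀) σ ∧
        -- the gradient in `x` of the derivative in `σ`
        HasGradientWithinAt
          (fun x' => derivWithin (fun s => lowerValue f g c.feasible x' s) (Icc 0 σ₀) σ)
          (mixedDerivative c f g x σ y lam nu) X x ∧
        -- the case `σ = 0⁺`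
        (σ = 0 →
          HasGradientWithinAt (hyperObjective f g c.feasible)
            (mixedDerivative c f g x σ y lam nu) X x ∧
          (∀ᶠ s in 𝓝[>] (0 : ℝ),
            DifferentiableWithinAt ℝ (penalized f g c.feasible s) X x) ∧
          Tendsto (fun s => gradientWithin (penalized f g c.feasible s) X x) (𝓝[>] (0 : ℝ))
            (𝓝 (gradientWithin (hyperObjective f g c.feasible) X x)))) := by
  refine ⟨?_, ?_⟩
  · intro p W F _ hconv hint hF w hw hlip θ lam nu h
    have hW := uniqueDiffOn_convex hconv hint
    refine ⟨?_, h.hasFDerivWithinAt_gradientWithin_valueFn hW hF hw hlip⟩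
    filter_upwards [hlip, self_mem_nhdsWithin] with w' hl hw'
    -- Away from `w` any minimizer will do, since the envelope formula requires no regularity.
    obtain ⟨y, hy⟩ := hF.nonempty_solutionSet (c.isCompact_feasible hbdd)
      ⟨θ, h.mem_solutionSet.1⟩ hw'
    exact (hF.hasFDerivWithinAt_valueFn hw' hl hy).differentiableWithinAt
  · intro n X f g σ₀ _ hconv hint hf hg hσ₀ x hx σ hσ hlip y lam nu h
    exact h.mixed_derivatives hbdd hconv hint hf hg hσ₀ hx hσ hlip
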